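/- **Proposition.** Let $\Delta$ be a diagram $x=w_1\to w_2\to\cdots\to w_n=x$ (reduced or not) over the semigroup presentation $$\mathcal P_{VF}=\langle x,v\mid s\to t_1t_2\ \ (s,t_1,t_2\in\{x,v\})\rangle ,$$ that is, a finite sequence of words with, for each step, a specified replacement $w'(p)w''\to w'(q)w''$ where $p\to q$ or $q\to p$ is a relation; so $\Delta$ represents an element of the virtual Thompson group $VF=\mathcal D(\mathcal P_{VF},x)$. Suppose that $\Delta$ satisfies the single-peak condition: there is a unique $i\in\{1,\dots,n\}$ with $|w_j|<|w_{j+1}|$ for $1\le j<i$ and $|w_j|>|w_{j+1}|$ for $i\le j<n$. View $\Delta$ also as a plane graph (the geometric diagram): start with one edge labeled $x$ from the initial to the terminal vertex, and for each step attach a cell from below along the sub-path $p$ of the bottom path, whose new bottom path is labeled $q$; all edges run from left to right. The *Thompson graph* $T(\Delta)$ is the labeled plane graph whose vertices are all vertices of $\Delta$ except the terminal one, and whose edges are the first (top-most) and the last (bottom-most) incoming edge of each inner vertex, with their labels; if these two coincide, the edge is doubled by a parallel copy with the same label. Let $(T_+,T_-)$ be the pair of binary trees with labeled edges associated with $\Delta$: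 each cell with paths $s$ and $t_1t_2$ is regarded as a caret with root $s$ and left and right children $t_1,t_2$, whose edges are labeled $t_1,t_2$; then $T_+$ is the largest tree with root on the top path of $\Delta$, and $T_-$ the largest tree with root on the bottom path. Then $T_+$ and $T_-$ have the same number of leaves, say $m+1$. Place the leaves at $(\tfrac12,0),\dots,(\tfrac{2m+1}2,0)$, with $T_+$ in the upper and $T_-$ (upside down) in the lower half-plane. The *$\Gamma$-graph* $\Gamma(T_+,T_-)$ is the labeled plane graph with vertices $(0,0),\dots,(m,0)$ that has, for each edge $e$ of $T_+$ (resp. $T_-$) from a parent to its left child, one edge in the upper (resp. lower) half-plane which crosses $e$ transversely exactly once and no other edge of the trees, and which has the label of $e$. The Thompson graph $T(\Delta)$ is isomorphic to $\Gamma(T_+,T_-)$ as a labeled plane graph, i.e. by an isomorphism of graphs that preserves the labels of the edges, the counterclockwise order of the edges around each vertex, and the unbounded face. -/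

import Mathlib

namespace VirtualThompson

/-! ### Diagrams of `VF` -/

/-- The two generators of the semigroup presentation. -/
inductive Letter
  | x
  | v
deriving DecidableEq

/-- Words on the generators. -/
abbrev Word := List Letter

/-- The cells.  The relations are `s → t₁t₂` for all letters `s, t₁, t₂` (these are the eight
relations `x → xx, vv, vx, xv` and `v → vv, xx, vx, xv`) and their inverses. -/
inductive Cell
  | split (s t₁ t₂ : Letter)
  | merge (t₁ t₂ s : Letter)

/-- The word that the cell replaces (its top path). -/
def Cell.top : Cell → Word
  | .split s _ _ => [s]
  | .merge t₁ t₂ _ => [t₁, t₂]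

/-- The word that replaces it (its bottom path). -/
def Cell.bot : Cell → Word
  | .split _ t₁ t₂ => [t₁, t₂]
  | .merge _ _ s => [s]

/-- The inverse cell. -/
def Cell.inv : Cell → Cell
  | .split s t₁ t₂ => .merge t₁ t₂ s
  | .merge t₁ t₂ s => .split s t₁ t₂

/-- One replacement `pre (cell.top) post → pre (cell.bot) post`. -/
structure Step where
  pre : Word
  cell : Cell
  post : Word

def Step.source (s : Step) : Word := s.pre ++ s.cell.top ++ s.post

def Step.target (s : Step) : Word := s.pre ++ s.cell.bot ++ s.post

def Step.inv (s : Step) : Step := ⟨s.pre, s.cell.inv, s.post⟩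

/-- The steps can be carried out one after the other, and lead from `w` to `w'`. -/
def IsRewriting : Word → List Step → Word → Prop
  | w, [], w' => w = w'
  | w, s :: l, w' => w = s.source ∧ IsRewriting s.target l w'

/-- A (not necessarily reduced) diagram `x = w₀ → w₁ → ⋯ → wₘ = x`, representing an element of
the diagram group `VF`. -/
structure Diagram where
  steps : List Step
  isRewriting : IsRewriting [Letter.x] steps [Letter.x]

/-- The word `wⱼ` of the diagram, for `0 ≤ j ≤ m`, where `m` is the number of steps. -/
def Diagram.word (Δ : Diagram) (j : ℕ) : Word :=
  ([Letter.x] :: Δ.steps.map Step.target).getD j []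

/-- The single-peak condition: for a unique index `i`, the lengths of the words increase strictly
up to `wᵢ` and decrease strictly from `wᵢ` on. -/
def Diagram.SinglePeak (Δ : Diagram) : Prop :=
  ∃! i : ℕ, i ≤ Δ.steps.length ∧
    (∀ j, j < i → (Δ.word j).length < (Δ.word (j + 1)).length) ∧
    (∀ j, i ≤ j → j < Δ.steps.length → (Δ.word (j + 1)).length < (Δ.word j).length)

/-! ### Labeled plane graphs -/

/-- A connected plane graph with edges labeled by letters, given by its combinatorial embedding.
Every edge consists of two darts `d` and `rev d`, and a dart is based at one end of its edge.
`rot u` is the counterclockwise cyclic order of the darts based at the vertex `u`. -/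
structure LabeledPlaneGraph where
  Vertex : Type
  Dart : Type
  rev : Dart → Dart
  rev_rev : ∀ d, rev (rev d) = d
  rev_ne : ∀ d, rev d ≠ d
  base : Dart → Vertex
  label : Dart → Letter
  label_rev : ∀ d, label (rev d) = label d
  rot : Vertex → Cycle Dart
  nodup_rot : ∀ u, (rot u).Nodup
  mem_rot : ∀ u d, d ∈ rot u ↔ base d = u
  /-- A dart that has the unbounded face on its left (none if there are no darts). -/
  outerDart : Option Dart
  isEmpty_of_outerDart : outerDart = none → IsEmpty Dart

namespace LabeledPlaneGraph

/-- The dart `d'` follows `d` on the boundary of the face to the left of `d`: at the vertex that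
`d` points to, `d'` is the next dart after `rev d` in clockwise direction, that is, the last
one when the darts are read counterclockwise beginning with `rev d`. -/
def FaceStep (G : LabeledPlaneGraph) (d d' : G.Dart) : Prop :=
  ∃ l : List G.Dart, (l : Cycle G.Dart) = G.rot (G.base (G.rev d)) ∧
    l.head? = some (G.rev d) ∧ l.getLast? = some d'

/-- The darts that have the unbounded face on their left. -/
def outerFace (G : LabeledPlaneGraph) : Set G.Dart :=
  {d | ∃ d₀, G.outerDart = some d₀ ∧ Relation.ReflTransGen G.FaceStep d₀ d}

/-- Isomorphisms of labeled plane graphs: isomorphisms of graphs that preserve the labels,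
the counterclockwise order around every vertex, and the unbounded face. -/
structure Iso (G H : LabeledPlaneGraph) where
  vertex : G.Vertex ≃ H.Vertex
  dart : G.Dart ≃ H.Dart
  map_rev : ∀ d, dart (G.rev d) = H.rev (dart d)
  map_base : ∀ d, H.base (dart d) = vertex (G.base d)
  map_label : ∀ d, H.label (dart d) = G.label d
  map_rot : ∀ u, (G.rot u).map dart = H.rot (vertex u)
  map_outerFace : ∀ d, dart d ∈ H.outerFace ↔ d ∈ G.outerFace

end LabeledPlaneGraph

/-- A labeled edge that is drawn from left to right, from the vertex `src` to the vertex `tgt`. -/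
structure PlaneEdge where
  src : ℕ
  tgt : ℕ
  label : Letter

/-- The plane graph with vertices `0, …, n - 1` whose edges are drawn from left to right and are
listed from top to bottom (if some point of an edge lies vertically above some point of another
one, then it is listed before the other one).  At each vertex, the counterclockwise order
consists of the incoming edges from top to bottom, followed by the outgoing edges from bottom to
top.  A dart is an edge `i` with a Boolean: `(i, true)` is based at the left end of the edge,
`(i, false)` at its right end.  Nothing lies above the first edge, so `(0, true)`, which runs
from left to right, has the unbounded face on its left. -/
def leftRightGraph (n : ℕ) (L : List PlaneEdge) (hL : ∀ e ∈ L, e.src < n ∧ e.tgt < n) :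
    LabeledPlaneGraph where
  Vertex := Fin n
  Dart := Fin L.length × Bool
  rev d := (d.1, !d.2)
  rev_rev d := by simp
  rev_ne d h := by
    have := congrArg Prod.snd h
    simp at this
  base d :=
    if d.2 then ⟨L[d.1].src, (hL _ (List.getElem_mem _)).1⟩
    else ⟨L[d.1].tgt, (hL _ (List.getElem_mem _)).2⟩
  label d := L[d.1].label
  label_rev _ := rfl
  rot u :=
    (((List.finRange L.length).filter (fun i => L[i].tgt = (u : ℕ))).map (fun i => (i, false)) ++
      ((List.finRange L.length).reverse.filter (fun i => L[i].src = (u : ℕ))).map (fun i => (i, true)) :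
      List (Fin L.length × Bool))
  nodup_rot u := by
    rw [Cycle.nodup_coe_iff, List.nodup_append]
    refine ⟨List.Nodup.map (fun a b h => by simpa using h)
        ((List.nodup_finRange _).filter _),
      List.Nodup.map (fun a b h => by simpa using h)
        ((List.nodup_reverse.2 (List.nodup_finRange _)).filter _), ?_⟩
    intro a ha b hb hab
    simp only [List.mem_map] at ha hb
    obtain ⟨i, -, rfl⟩ := ha
    obtain ⟨j, -, rfl⟩ := hb
    simp at hab
  mem_rot u d := by
    obtain ⟨i, b⟩ := d
    cases b <;> simp <;> rw [← Fin.val_inj]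
  outerDart := if h : 0 < L.length then some (⟨0, h⟩, true) else none
  isEmpty_of_outerDart h := by
    have h0 : L.length = 0 := by
      by_contra hne
      simp [Nat.pos_of_ne_zero hne] at h
    exact ⟨fun d => absurd d.1.2 (by omega)⟩

/-! ### Geometric diagrams and the Thompson graph -/

/-- An oriented labeled edge of a geometric diagram.  The vertices other than the terminal one
are natural numbers; the target `none` is the terminal vertex. -/
structure DiagramEdge where
  src : ℕ
  tgt : Option ℕ
  label : Letter

/-- A geometric diagram.  Its vertices are `0` (the initial vertex), `1, …, numVertices - 1`
(the inner vertices), and the terminal vertex.  The edges are listed in the order in which they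
were attached.  As cells are attached from below, this order is from top to bottom, for the
incoming edges of a vertex and for its outgoing edges.  `bottom` lists the vertices
of the bottom path from left to right, without the terminal vertex. -/
structure GeometricDiagram where
  numVertices : ℕ
  edges : List DiagramEdge
  bottom : List ℕ

/-- The trivial geometric diagram of the word `x`. -/
def GeometricDiagram.trivial : GeometricDiagram := ⟨1, [⟨0, none, Letter.x⟩], [0]⟩

/-- Attach the cell of a step along the bottom path.  The next vertex on the bottom path is
the terminal one (`none`) when the list is exhausted.  The last case does not occur for the
steps of a diagram. -/
def GeometricDiagram.attach (G : GeometricDiagram) (s : Step) : GeometricDiagram :=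
  match s.cell, G.bottom.drop s.pre.length with
  | .split _ t₁ t₂, a :: rest =>
    { numVertices := G.numVertices + 1
      edges := G.edges ++
        [⟨a, some G.numVertices, t₁⟩, ⟨G.numVertices, rest.head?, t₂⟩]
      bottom := G.bottom.take s.pre.length ++ a :: G.numVertices :: rest }
  | .merge _ _ t, a :: _ :: rest =>
    { numVertices := G.numVertices
      edges := G.edges ++ [⟨a, rest.head?, t⟩]
      bottom := G.bottom.take s.pre.length ++ a :: rest }
  | _, _ => G

/-- The geometric diagram of `Δ`. -/
def Diagram.geometric (Δ : Diagram) : GeometricDiagram :=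
  Δ.steps.foldl GeometricDiagram.attach GeometricDiagram.trivial

namespace GeometricDiagram

/-- The edge `i` is the first (top-most) incoming edge of its target. -/
def IsFirst (G : GeometricDiagram) (i : Fin G.edges.length) : Prop :=
  ∀ j : Fin G.edges.length, G.edges[j].tgt = G.edges[i].tgt → i ≤ j

/-- The edge `i` is the last (bottom-most) incoming edge of its target. -/
def IsLast (G : GeometricDiagram) (i : Fin G.edges.length) : Prop :=
  ∀ j : Fin G.edges.length, G.edges[j].tgt = G.edges[i].tgt → j ≤ i

instance (G : GeometricDiagram) : DecidablePred G.IsFirst :=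
  fun _ => inferInstanceAs (Decidable (∀ _, _))

instance (G : GeometricDiagram) : DecidablePred G.IsLast :=
  fun _ => inferInstanceAs (Decidable (∀ _, _))

/-- The edges of the Thompson graph from top to bottom: the first and the last incoming edge of
every inner vertex.  An edge that is both occurs twice, the copy immediately below the edge. -/
def thompsonEdges (G : GeometricDiagram) : List PlaneEdge :=
  (List.finRange G.edges.length).flatMap fun i =>
    match G.edges[i].tgt with
    | none => []
    | some u =>
      (if G.IsFirst i then [⟨G.edges[i].src, u, G.edges[i].label⟩] else []) ++
      (if G.IsLast i then [⟨G.edges[i].src, u, G.edges[i].label⟩] else [])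

/-- All vertices that occur are among the declared ones. -/
def WellFormed (G : GeometricDiagram) : Prop :=
  (∀ e ∈ G.edges, e.src < G.numVertices ∧ ∀ u, e.tgt = some u → u < G.numVertices) ∧
    ∀ u ∈ G.bottom, u < G.numVertices

theorem WellFormed.attach {G : GeometricDiagram} (hG : G.WellFormed) (s : Step) :
    (G.attach s).WellFormed := by
  obtain ⟨h1, h2⟩ := hG
  have hd : ∀ u ∈ G.bottom.drop s.pre.length, u < G.numVertices :=
    fun u hu => h2 u (List.mem_of_mem_drop hu)
  have ht : ∀ u ∈ G.bottom.take s.pre.length, u < G.numVertices :=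
    fun u hu => h2 u (List.mem_of_mem_take hu)
  unfold GeometricDiagram.attach
  split
  · rename_i a rest _ heq
    rw [heq] at hd
    have hr : ∀ u, rest.head? = some u → u < G.numVertices :=
      fun u hu => hd u (List.mem_cons_of_mem _ (List.mem_of_mem_head? hu))
    have ha := hd a (by simp)
    refine ⟨fun e he => ?_, fun u hu => ?_⟩
    · simp only [List.mem_append, List.mem_cons, List.not_mem_nil, or_false] at he
      rcases he with he | rfl | rfl
      · exact ⟨Nat.lt_succ_of_lt (h1 e he).1, fun u hu => Nat.lt_succ_of_lt ((h1 e he).2 u hu)⟩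
      · exact ⟨Nat.lt_succ_of_lt ha, fun u hu => by simp at hu; simp [← hu]⟩
      · exact ⟨Nat.lt_succ_self _, fun u hu => Nat.lt_succ_of_lt (hr u hu)⟩
    · simp only [List.mem_append, List.mem_cons] at hu
      rcases hu with hu | rfl | rfl | hu
      · exact Nat.lt_succ_of_lt (ht u hu)
      · exact Nat.lt_succ_of_lt ha
      · exact Nat.lt_succ_self _
      · exact Nat.lt_succ_of_lt (hd u (List.mem_cons_of_mem _ hu))
  · rename_i a b rest _ heq
    rw [heq] at hd
    have ha := hd a (by simp)
    have hr : ∀ u ∈ rest, u < G.numVertices := fun u hu => hd u (by simp [hu])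
    refine ⟨fun e he => ?_, fun u hu => ?_⟩
    · simp only [List.mem_append, List.mem_cons, List.not_mem_nil, or_false] at he
      rcases he with he | rfl
      · exact h1 e he
      · exact ⟨ha, fun u hu => hr u (List.mem_of_mem_head? hu)⟩
    · simp only [List.mem_append, List.mem_cons] at hu
      rcases hu with hu | rfl | hu
      · exact ht u hu
      · exact ha
      · exact hr u hu
  · exact ⟨h1, h2⟩

theorem wellFormed_foldl (l : List Step) {G : GeometricDiagram} (hG : G.WellFormed) :
    (l.foldl GeometricDiagram.attach G).WellFormed := by
  induction l generalizing G with
  | nil => exact hG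
  | cons s l ih => exact ih (hG.attach s)

theorem WellFormed.thompsonEdges_lt {G : GeometricDiagram} (hG : G.WellFormed) :
    ∀ e ∈ G.thompsonEdges, e.src < G.numVertices ∧ e.tgt < G.numVertices := by
  intro e he
  simp only [thompsonEdges, List.mem_flatMap] at he
  obtain ⟨i, -, he⟩ := he
  have hi := hG.1 G.edges[i] (List.getElem_mem _)
  split at he
  · simp at he
  · rename_i u hu
    have hu' := hi.2 u hu
    have hs := hi.1
    simp only [List.mem_append] at he
    rcases he with he | he <;> split at he <;> simp at he <;> subst he <;> exact ⟨hs, hu'⟩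

end GeometricDiagram

theorem Diagram.geometric_wellFormed (Δ : Diagram) : Δ.geometric.WellFormed :=
  GeometricDiagram.wellFormed_foldl _ (by
    simp [GeometricDiagram.WellFormed, GeometricDiagram.trivial])

/-- The Thompson graph `T(Δ)`: its vertices are all vertices of the geometric diagram except the
terminal one, its edges are the first and the last incoming edges of the inner vertices, and
the plane embedding is the one of the geometric diagram. -/
def Diagram.thompsonGraph (Δ : Diagram) : LabeledPlaneGraph :=
  leftRightGraph Δ.geometric.numVertices Δ.geometric.thompsonEdges
    Δ.geometric_wellFormed.thompsonEdges_lt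

/-! ### Labeled binary trees and the `Γ`-graph -/

/-- Binary trees with labeled edges: `node l A r B` has the left subtree `A`, at an edge labeled
`l`, and the right subtree `B`, at an edge labeled `r`. -/
inductive LabeledTree
  | leaf
  | node (l : Letter) (A : LabeledTree) (r : Letter) (B : LabeledTree)

def LabeledTree.numLeaves : LabeledTree → ℕ
  | .leaf => 1
  | .node _ A _ B => A.numLeaves + B.numLeaves

/-- For each edge of the bottom path, from left to right, the largest tree that grows upwards
from it, where a cell `t₁t₂ → s` is a caret whose root is at `s` and whose children are at
`t₁` and `t₂`, with edges labeled `t₁` and `t₂`.  This function describes how these trees change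
when a step is added.  The last case does not occur for the steps of a diagram. -/
def treeStep (F : List LabeledTree) (s : Step) : List LabeledTree :=
  match s.cell, F.drop s.pre.length with
  | .split _ _ _, _ :: rest =>
    F.take s.pre.length ++ LabeledTree.leaf :: LabeledTree.leaf :: rest
  | .merge t₁ t₂ _, A :: B :: rest =>
    F.take s.pre.length ++ LabeledTree.node t₁ A t₂ B :: rest
  | _, _ => F

/-- The largest tree whose root is on the bottom path `x`, for a list of steps
from `x` to `x`. -/
def bottomTree (l : List Step) : LabeledTree :=
  (l.foldl treeStep [LabeledTree.leaf]).headD LabeledTree.leaf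

/-- The tree `T₋` of a diagram: the largest tree whose root is on the bottom path. -/
def Diagram.lowerTree (Δ : Diagram) : LabeledTree := bottomTree Δ.steps

/-- The tree `T₊` of a diagram: the largest tree whose root is on the top path, which is the
bottom path of the diagram turned upside down. -/
def Diagram.upperTree (Δ : Diagram) : LabeledTree := bottomTree (Δ.steps.reverse.map Step.inv)

/-- Let the leaves of the tree be at `o + 1/2, o + 3/2, …` on the real line, with the tree in
one of the two half-planes.  For each left edge of the tree (from a parent to its left child), an
arc in that half-plane between two integer points that crosses this edge once, and no other edge
of the tree, encloses exactly the leaves of the left child.  Hence it runs from the integer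
just left of the first one of these leaves to the integer just right of the last one.  It has the
label of the left edge.  The arcs are listed such that an arc comes before all arcs that it
encloses. -/
def LabeledTree.leftArcs : LabeledTree → ℕ → List PlaneEdge
  | .leaf, _ => []
  | .node l A _ B, o =>
    ⟨o, o + A.numLeaves, l⟩ :: (A.leftArcs o ++ B.leftArcs (o + A.numLeaves))

theorem LabeledTree.numLeaves_pos (t : LabeledTree) : 0 < t.numLeaves := by
  induction t with
  | leaf => simp [numLeaves]
  | node l A r B ihA ihB => simp only [numLeaves]; omega

theorem LabeledTree.leftArcs_lt (t : LabeledTree) (o : ℕ) :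
    ∀ e ∈ t.leftArcs o, e.src < o + t.numLeaves ∧ e.tgt < o + t.numLeaves := by
  induction t generalizing o with
  | leaf => simp [leftArcs]
  | node l A r B ihA ihB =>
    intro e he
    have hA := A.numLeaves_pos
    have hB := B.numLeaves_pos
    simp only [leftArcs, List.mem_cons, List.mem_append] at he
    simp only [numLeaves]
    rcases he with rfl | he | he
    · dsimp only
      omega
    · have := ihA o e he
      omega
    · have := ihB _ e he
      omega

/-- The `Γ`-graph of a pair of labeled binary trees with the same number `n + 1` of leaves at
`1/2, 3/2, …, n + 1/2`, where `T₊` is in the upper and `T₋` in the lower half-plane.  Its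
vertices are the points `0, …, n` of the real line.  Its edges are the arcs across the left edges
of `T₊`, in the upper half-plane (from top to bottom, an arc comes before those that it encloses),
followed by the arcs across the left edges of `T₋` (drawn from top left to bottom right, as `T₋` is
upside down), in the lower half-plane (where it comes after those that it encloses). -/
def gammaGraph (Tp Tm : LabeledTree) (h : Tp.numLeaves = Tm.numLeaves) : LabeledPlaneGraph :=
  leftRightGraph Tp.numLeaves (Tp.leftArcs 0 ++ (Tm.leftArcs 0).reverse) (by
    intro e he
    simp only [List.mem_append, List.mem_reverse] at he
    rcases he with he | he
    · simpa using Tp.leftArcs_lt 0 e he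
    · simpa [h] using Tm.leftArcs_lt 0 e he)

end VirtualThompson

/-! The single-peak condition forces every step before the peak to be a splitting and every step
after it to be an inverse splitting (`Diagram.SinglePeak.exists_append`). Merges create no vertices,
so the bottom path at the peak passes through all vertices of the diagram. Let `p u` be the position
of the vertex `u` on that path; the gaps after these positions are the common leaves of both trees.

A splitting of an edge that starts at `a` creates one vertex `u`. Its first incoming edge is then
the edge `a → u` bearing the left letter of the cell, and it stays the first one, since all later
cells are attached below. The leaves under this left child are those between `p a` and `p u`, so the
edge is the arc of `T₊` across the left edge of the caret. Dually, a merge of `a → b → c` takes `b`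
off the bottom path, so that `a → b` remains the last incoming edge of `b`; it is the arc of `T₋`.
Thus after renumbering by `p` both graphs have the same edges (`Merges.bottomTree_spec`, `SplitInv`,
`MergeInv`).

The two lists order these edges differently: by time of attachment on one side, by the recursion on
trees on the other. The plane structure only sees the order among edges with a common source or a
common target, and the top edge, which marks the unbounded face. The relation `Above` fixes that
order from the end points and from a tag that tells first from last edges; the tag also separates
the two copies of a doubled edge. Both lists are pairwise `Above` and have the same members, so the
bijection of edges respects the embedding (`exists_equiv_of_pairwise_above`). -/

namespace VirtualThompson

/-! ### Isomorphisms of left-right graphs -/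

/-- Renumbering of the vertices of an edge. -/
def PlaneEdge.relabel (p : ℕ → ℕ) (e : PlaneEdge) : PlaneEdge := ⟨p e.src, p e.tgt, e.label⟩

theorem leftRightGraph_outerDart_map {n n' : ℕ} {L L' : List PlaneEdge}
    (hL : ∀ e ∈ L, e.src < n ∧ e.tgt < n) (hL' : ∀ e ∈ L', e.src < n' ∧ e.tgt < n')
    (σ : Fin L.length ≃ Fin L'.length) (hhead : ∀ i, i.val = 0 → (σ i).val = 0) :
    (leftRightGraph n' L' hL').outerDart =
      (leftRightGraph n L hL).outerDart.map (fun d => (σ d.1, d.2)) := by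
  have hlen : L.length = L'.length := by simpa using Fintype.card_congr σ
  by_cases h : 0 < L.length
  · have h' : 0 < L'.length := hlen ▸ h
    have := hhead ⟨0, h⟩ rfl
    simp only [leftRightGraph, h, h', dif_pos, Option.map_some, Option.some.injEq, Prod.mk.injEq,
      and_true]
    exact Fin.ext this.symm
  · have h' : ¬ 0 < L'.length := hlen ▸ h
    simp only [leftRightGraph, h, h', dif_neg, not_false_eq_true, Option.map_none]

namespace LabeledPlaneGraph

theorem FaceStep.map {G H : LabeledPlaneGraph} (φ : G.Vertex → H.Vertex) (δ : G.Dart → H.Dart)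
    (map_rev : ∀ d, δ (G.rev d) = H.rev (δ d)) (map_base : ∀ d, H.base (δ d) = φ (G.base d))
    (map_rot : ∀ u, (G.rot u).map δ = H.rot (φ u)) {d d' : G.Dart} (h : G.FaceStep d d') :
    H.FaceStep (δ d) (δ d') := by
  obtain ⟨l, h1, h2, h3⟩ := h
  refine ⟨l.map δ, ?_, ?_, ?_⟩
  · rw [← map_rev, map_base, ← map_rot, ← h1, Cycle.map_coe]
  · rw [List.head?_map, h2, Option.map_some, map_rev]
  · rw [List.getLast?_map, h3, Option.map_some]

/-- The face relation is defined from `rev`, `base` and `rot` alone, so paths of face steps that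
begin at the outer dart are carried to such paths. -/
theorem map_mem_outerFace {G H : LabeledPlaneGraph} (φ : G.Vertex → H.Vertex)
    (δ : G.Dart → H.Dart) (map_rev : ∀ d, δ (G.rev d) = H.rev (δ d))
    (map_base : ∀ d, H.base (δ d) = φ (G.base d))
    (map_rot : ∀ u, (G.rot u).map δ = H.rot (φ u)) (houter : H.outerDart = G.outerDart.map δ)
    {d : G.Dart} (h : d ∈ G.outerFace) : δ d ∈ H.outerFace := by
  obtain ⟨d₀, h0, h1⟩ := h
  exact ⟨δ d₀, by rw [houter, h0, Option.map_some],
    h1.lift δ fun _ _ h => h.map φ δ map_rev map_base map_rot⟩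

/-- A map of darts that is compatible with the embedding and maps the outer dart to the outer dart
preserves the unbounded face. -/
def Iso.ofOuterDart {G H : LabeledPlaneGraph} (φ : G.Vertex ≃ H.Vertex) (δ : G.Dart ≃ H.Dart)
    (map_rev : ∀ d, δ (G.rev d) = H.rev (δ d)) (map_base : ∀ d, H.base (δ d) = φ (G.base d))
    (map_label : ∀ d, H.label (δ d) = G.label d)
    (map_rot : ∀ u, (G.rot u).map δ = H.rot (φ u)) (houter : H.outerDart = G.outerDart.map δ) :
    Iso G H where
  vertex := φ
  dart := δ
  map_rev := map_rev
  map_base := map_base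
  map_label := map_label
  map_rot := map_rot
  map_outerFace d := by
    refine ⟨fun h => ?_, map_mem_outerFace φ δ map_rev map_base map_rot houter⟩
    have := map_mem_outerFace φ.symm δ.symm (fun d => by rw [Equiv.symm_apply_eq, map_rev]; simp)
      (fun d => by rw [Equiv.eq_symm_apply, ← map_base]; simp)
      (fun u => by
        obtain ⟨u, rfl⟩ := φ.surjective u
        rw [← map_rot, Equiv.symm_apply_apply]
        induction G.rot u using Cycle.induction_on <;> simp [Cycle.map_coe])
      (by rw [houter, Option.map_map]; simp) h
    simpa using this

end LabeledPlaneGraph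

/-- Both lists are strictly increasing and have the same members. Monotonicity is only needed on the
selected indices, which is what makes an order-breaking bijection of all edges admissible as long as
it is monotone at each vertex. -/
theorem map_filter_finRange {m m' : ℕ} (σ : Fin m ≃ Fin m') (P : Fin m → Prop) [DecidablePred P]
    (Q : Fin m' → Prop) [DecidablePred Q] (hPQ : ∀ i, P i ↔ Q (σ i))
    (hmono : ∀ i j, P i → P j → i < j → σ i < σ j) :
    ((List.finRange m).filter P).map σ = (List.finRange m').filter Q := by
  refine List.Perm.eq_of_pairwise (le := (· < ·)) (fun a b _ _ h h' => absurd h' h.not_gt) ?_ ?_ ?_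
  · rw [List.pairwise_map, List.pairwise_filter]
    refine (List.pairwise_lt_finRange m).imp fun {i j} hij hi hj => ?_
    exact hmono _ _ (by simpa using hi) (by simpa using hj) hij
  · exact (List.pairwise_lt_finRange m').filter _
  · rw [List.perm_ext_iff_of_nodup]
    · intro j
      obtain ⟨i, rfl⟩ := σ.surjective j
      simp [hPQ]
    · exact ((List.nodup_finRange m).filter _).map σ.injective
    · exact (List.nodup_finRange m').filter _

/-- Left-right graphs are isomorphic if there is a bijection of their edges that preserves the order
of edges with a common source, the order of edges with a common target, and the first edge. -/
def leftRightGraphIso {n n' : ℕ} {L L' : List PlaneEdge}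
    (hL : ∀ e ∈ L, e.src < n ∧ e.tgt < n) (hL' : ∀ e ∈ L', e.src < n' ∧ e.tgt < n')
    (p : ℕ → ℕ) (φ : Fin n ≃ Fin n') (hφ : ∀ u, (φ u : ℕ) = p u)
    (σ : Fin L.length ≃ Fin L'.length) (hσ : ∀ i, L'[σ i] = L[i].relabel p)
    (hsrc : ∀ i j, L[i].src = L[j].src → i < j → σ i < σ j)
    (htgt : ∀ i j, L[i].tgt = L[j].tgt → i < j → σ i < σ j)
    (hhead : ∀ i, i.val = 0 → (σ i).val = 0) :
    LabeledPlaneGraph.Iso (leftRightGraph n L hL) (leftRightGraph n' L' hL') := by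
  have hinj : ∀ {a b : ℕ}, a < n → b < n → (p a = p b ↔ a = b) := by
    intro a b ha hb
    refine ⟨fun h => ?_, fun h => by rw [h]⟩
    have : φ ⟨a, ha⟩ = φ ⟨b, hb⟩ := Fin.ext (by rw [hφ, hφ]; exact h)
    simpa using this
  have hbase : ∀ (i : Fin L.length) (b : Bool),
      (if b then (⟨L'[σ i].src, (hL' _ (List.getElem_mem _)).1⟩ : Fin n')
        else ⟨L'[σ i].tgt, (hL' _ (List.getElem_mem _)).2⟩) =
      φ (if b then ⟨L[i].src, (hL _ (List.getElem_mem _)).1⟩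
        else ⟨L[i].tgt, (hL _ (List.getElem_mem _)).2⟩) := by
    intro i b
    apply Fin.ext
    rw [hφ]
    cases b
    · exact congrArg PlaneEdge.tgt (hσ i)
    · exact congrArg PlaneEdge.src (hσ i)
  have hrot : ∀ u : Fin n,
      (((List.finRange L.length).filter (fun i => L[i].tgt = (u : ℕ))).map (fun i => (i, false)) ++
        ((List.finRange L.length).reverse.filter (fun i => L[i].src = (u : ℕ))).map
          (fun i => (i, true))).map (σ.prodCongr (Equiv.refl Bool)) =
      ((List.finRange L'.length).filter (fun i => L'[i].tgt = (φ u : ℕ))).map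
          (fun i => (i, false)) ++
        ((List.finRange L'.length).reverse.filter (fun i => L'[i].src = (φ u : ℕ))).map
          (fun i => (i, true)) := by
    intro u
    have h1 := map_filter_finRange σ (fun i => L[i].tgt = (u : ℕ)) (fun i => L'[i].tgt = (φ u : ℕ))
      (fun i => by rw [hσ, hφ]; exact (hinj (hL _ (List.getElem_mem _)).2 u.2).symm)
      (fun i j hi hj => htgt i j (hi.trans hj.symm))
    have h2 := map_filter_finRange σ (fun i => L[i].src = (u : ℕ)) (fun i => L'[i].src = (φ u : ℕ))
      (fun i => by rw [hσ, hφ]; exact (hinj (hL _ (List.getElem_mem _)).1 u.2).symm)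
      (fun i j hi hj => hsrc i j (hi.trans hj.symm))
    rw [List.filter_reverse, List.filter_reverse, ← h1, ← h2]
    simp [List.map_map, Function.comp_def]
  have hlabel : ∀ i, L'[σ i].label = L[i].label := fun i => by rw [hσ]; rfl
  exact LabeledPlaneGraph.Iso.ofOuterDart φ (σ.prodCongr (Equiv.refl Bool)) (fun _ => rfl)
    (fun d => hbase d.1 d.2) (fun d => hlabel d.1)
    (fun u => congrArg (Cycle.ofList (α := Fin L'.length × Bool)) (hrot u))
    (leftRightGraph_outerDart_map hL hL' σ hhead)

/-! ### The order of edges at a vertex -/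

/-- The edge `x` of a tagged list of edges may stand before `y`: tagged edges with the same target
have different tags, and those with tag `true` come first; edges with the same source are listed
from top to bottom, where those with tag `true` run above the others. -/
def Above (x y : Bool × PlaneEdge) : Prop :=
  (x.2.tgt = y.2.tgt → x.1 = true ∧ y.1 = false) ∧
    (x.2.src = y.2.src → (x.1 = true ∧ y.1 = false) ∨
      (x.1 = true ∧ y.1 = true ∧ y.2.tgt < x.2.tgt) ∨
      (x.1 = false ∧ y.1 = false ∧ x.2.tgt < y.2.tgt))

theorem not_above_self (x : Bool × PlaneEdge) : ¬ Above x x := by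
  rintro ⟨h, -⟩
  have := h rfl
  simp_all

/-- `Above` holds vacuously in both directions for edges with different sources and different
targets; antisymmetry is available exactly where the embedding depends on the order. -/
theorem Above.asymm_of_src {x y : Bool × PlaneEdge} (h : Above x y) (h' : Above y x) :
    x.2.src ≠ y.2.src := by
  intro e
  have h1 := h.2 e
  have h2 := h'.2 e.symm
  obtain ⟨b, x⟩ := x
  obtain ⟨c, y⟩ := y
  cases b <;> cases c <;> simp at h1 h2
  · omega
  · omega

theorem Above.asymm_of_tgt {x y : Bool × PlaneEdge} (h : Above x y) (h' : Above y x) :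
    x.2.tgt ≠ y.2.tgt := by
  intro e
  have h1 := h.1 e
  have h2 := h'.1 e.symm
  simp_all

theorem nodup_of_pairwise_above {T : List (Bool × PlaneEdge)} (h : T.Pairwise Above) : T.Nodup :=
  List.Pairwise.imp (S := (· ≠ ·)) (fun hxy e => not_above_self _ (e ▸ hxy)) h

/-- Entries of a pairwise `Above` list are distinct, so matching equal entries gives a bijection. If
it inverted two edges, these would be `Above` each other in both directions, which a common source
or target excludes. -/
theorem exists_equiv_of_pairwise_above {T T' : List (Bool × PlaneEdge)} (hA : T.Pairwise Above)
    (hA' : T'.Pairwise Above) (hmem : ∀ y, y ∈ T' ↔ y ∈ T)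
    (hhead : ∀ x ∈ T.head?, ∀ y ∈ T'.head?, x.2.src = y.2.src) :
    ∃ σ : Fin T.length ≃ Fin T'.length, (∀ i, T'[σ i] = T[i]) ∧
      (∀ i j, T[i].2.src = T[j].2.src → i < j → σ i < σ j) ∧
      (∀ i j, T[i].2.tgt = T[j].2.tgt → i < j → σ i < σ j) ∧
      (∀ i, i.val = 0 → (σ i).val = 0) := by
  classical
  have hn := nodup_of_pairwise_above hA
  have hn' := nodup_of_pairwise_above hA'
  let σ : Fin T.length ≃ Fin T'.length := (List.Nodup.getEquiv T hn).trans
    ((Equiv.subtypeEquivRight fun y => (hmem y).symm).trans (List.Nodup.getEquiv T' hn').symm)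
  have hσ : ∀ i, T'[σ i] = T[i] := by
    intro i
    have := congrArg Subtype.val ((List.Nodup.getEquiv T' hn').apply_symm_apply
      ((Equiv.subtypeEquivRight fun y => (hmem y).symm) (List.Nodup.getEquiv T hn i)))
    exact this
  have key : ∀ i j, i < j → σ j ≤ σ i → Above T[i] T[j] ∧ Above T[j] T[i] := by
    intro i j hij hji
    have hlt : σ j < σ i := lt_of_le_of_ne hji fun e => hij.ne' (σ.injective e)
    refine ⟨List.pairwise_iff_getElem.1 hA _ _ _ _ hij, ?_⟩
    rw [← hσ i, ← hσ j]
    exact List.pairwise_iff_getElem.1 hA' _ _ _ _ hlt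
  refine ⟨σ, hσ, ?_, ?_, ?_⟩
  · intro i j e hij
    by_contra hlt
    have := key i j hij (not_lt.1 hlt)
    exact this.1.asymm_of_src this.2 e
  · intro i j e hij
    by_contra hlt
    have := key i j hij (not_lt.1 hlt)
    exact this.1.asymm_of_tgt this.2 e
  · intro i hi
    by_contra hne
    have hT' : 0 < T'.length := (Nat.zero_le _).trans_lt (σ i).2
    -- If the first edge of `T` were not sent to the first edge of `T'`, the latter would come from
    -- a later `j`. The two would be inverted although `hhead` gives them the same source.
    obtain ⟨j, hj⟩ := σ.surjective ⟨0, hT'⟩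
    have hij : i < j := by
      rw [Fin.lt_def, hi]
      refine Nat.pos_of_ne_zero fun h0 => hne ?_
      have : i = j := Fin.ext (hi.trans h0.symm)
      rw [this, hj]
    have := key i j hij (by rw [hj]; exact Nat.zero_le _)
    refine this.1.asymm_of_src this.2 (hhead _ ?_ _ ?_)
    · rw [Option.mem_def, List.head?_eq_getElem?, List.getElem?_eq_some_iff]
      exact ⟨by omega, by simp [hi]⟩
    · rw [← hσ j, Option.mem_def, List.head?_eq_getElem?, List.getElem?_eq_some_iff]
      exact ⟨hT', by simp [hj]⟩

theorem nonempty_leftRightGraphIso {n n' : ℕ} {L L' : List PlaneEdge}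
    (hL : ∀ e ∈ L, e.src < n ∧ e.tgt < n) (hL' : ∀ e ∈ L', e.src < n' ∧ e.tgt < n')
    (p : ℕ → ℕ) (φ : Fin n ≃ Fin n') (hφ : ∀ u, (φ u : ℕ) = p u) {T T' : List (Bool × PlaneEdge)}
    (hT : T.map Prod.snd = L) (hT' : T'.map Prod.snd = L')
    (hA : (T.map (Prod.map id (PlaneEdge.relabel p))).Pairwise Above) (hA' : T'.Pairwise Above)
    (hmem : ∀ y, y ∈ T' ↔ y ∈ T.map (Prod.map id (PlaneEdge.relabel p)))
    (hhead : ∀ x ∈ T.head?, ∀ y ∈ T'.head?, p x.2.src = y.2.src) :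
    Nonempty (LabeledPlaneGraph.Iso (leftRightGraph n L hL) (leftRightGraph n' L' hL')) := by
  subst hT hT'
  obtain ⟨σ, h1, h2, h3, h4⟩ := exists_equiv_of_pairwise_above hA hA' hmem (by
    intro x hx y hy
    rw [List.head?_map, Option.mem_def, Option.map_eq_some_iff] at hx
    obtain ⟨x', hx', rfl⟩ := hx
    exact hhead x' hx' y hy)
  have hc : (T.map Prod.snd).length =
    (T.map (Prod.map id (PlaneEdge.relabel p))).length := by simp
  have hc' : T'.length = (T'.map Prod.snd).length := by simp
  have hget : ∀ i : Fin (T.map Prod.snd).length,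
      (T.map (Prod.map id (PlaneEdge.relabel p)))[Fin.cast hc i].2 =
        (T.map Prod.snd)[i].relabel p := by
    intro i
    simp only [Fin.getElem_fin, List.getElem_map, Fin.val_cast, Prod.map_snd]
  refine ⟨leftRightGraphIso hL hL' p φ hφ
    ((finCongr hc).trans (σ.trans (finCongr hc'))) ?_ ?_ ?_ ?_⟩
  · intro i
    rw [← hget, ← h1]
    simp only [Fin.getElem_fin, List.getElem_map, Equiv.trans_apply, finCongr_apply, Fin.val_cast]
  · intro i j e hij
    exact h2 (Fin.cast hc i) (Fin.cast hc j) (by rw [hget, hget]; exact congrArg p e) hij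
  · intro i j e hij
    exact h3 (Fin.cast hc i) (Fin.cast hc j) (by rw [hget, hget]; exact congrArg p e) hij
  · intro i hi
    exact h4 (Fin.cast hc i) hi

/-! ### The first and last incoming edges -/

/-- The tagged list of the first (tag `true`) and last (tag `false`) incoming edges, when an edge is
attached from below. -/
def insertEdge (T : List (Bool × PlaneEdge)) (e : DiagramEdge) : List (Bool × PlaneEdge) :=
  match e.tgt with
  | none => T
  | some u =>
    T.filter (fun x => x.1 || decide (x.2.tgt ≠ u)) ++
      ((if ∀ x ∈ T, x.2.tgt ≠ u then [(true, ⟨e.src, u, e.label⟩)] else []) ++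
        [(false, ⟨e.src, u, e.label⟩)])

/-- The first (tag `true`) and last (tag `false`) incoming edges of the inner vertices, from top to
bottom. -/
def taggedEdges (E : List DiagramEdge) : List (Bool × PlaneEdge) := E.foldl insertEdge []

theorem exists_mem_insertEdge {T : List (Bool × PlaneEdge)} {e : DiagramEdge} {u : ℕ} :
    (∃ x ∈ insertEdge T e, x.2.tgt = u) ↔ (∃ x ∈ T, x.2.tgt = u) ∨ e.tgt = some u := by
  unfold insertEdge
  split
  · rename_i h
    simp [h]
  · rename_i w h
    rw [h]
    simp only [List.mem_append, List.mem_filter, Option.some.injEq, List.mem_singleton]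
    constructor
    · rintro ⟨x, (⟨hx, -⟩ | hx | rfl), hu⟩
      · exact Or.inl ⟨x, hx, hu⟩
      · split at hx
        · simp only [List.mem_singleton] at hx
          subst hx
          exact Or.inr hu
        · simp at hx
      · exact Or.inr hu
    · rintro (⟨x, hx, hu⟩ | rfl)
      · by_cases hw : w = u
        · exact ⟨_, Or.inr (Or.inr rfl), hw⟩
        · exact ⟨x, Or.inl ⟨hx, by simp [hu, Ne.symm hw]⟩, hu⟩
      · exact ⟨_, Or.inr (Or.inr rfl), rfl⟩

theorem exists_mem_taggedEdges {E : List DiagramEdge} {u : ℕ} :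
    (∃ x ∈ taggedEdges E, x.2.tgt = u) ↔ ∃ e ∈ E, e.tgt = some u := by
  induction E using List.reverseRecOn with
  | nil => simp [taggedEdges]
  | append_singleton E e ih =>
    rw [taggedEdges, List.foldl_append, List.foldl_cons, List.foldl_nil, exists_mem_insertEdge,
      ← taggedEdges, ih]
    simp [or_and_right, exists_or]

/-- The part of the tagged list that belongs to an edge. -/
def edgeCopies (e : DiagramEdge) (first last : Prop) [Decidable first] [Decidable last] :
    List (Bool × PlaneEdge) :=
  match e.tgt with
  | none => []
  | some u => (if first then [(true, ⟨e.src, u, e.label⟩)] else []) ++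
      (if last then [(false, ⟨e.src, u, e.label⟩)] else [])

theorem edgeCopies_congr (e : DiagramEdge) (first last last' : Prop) [Decidable first]
    [Decidable last] [Decidable last'] (h : e.tgt ≠ none → (last ↔ last')) :
    edgeCopies e first last = edgeCopies e first last' := by
  unfold edgeCopies
  split
  · rfl
  · rename_i u hu
    simp only [h (by simp [hu])]

theorem flatMap_finRange_of_eq_succ {α : Type*} {n m : ℕ} (h : n = m + 1) (f : Fin n → List α) :
    (List.finRange n).flatMap f =
      ((List.finRange m).flatMap fun i => f (Fin.cast h.symm i.castSucc)) ++
        f (Fin.cast h.symm (Fin.last m)) := by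
  subst h
  simp [List.finRange_succ_last, List.flatMap_map]

theorem filter_edgeCopies (e : DiagramEdge) (first last first' last' : Prop) [Decidable first]
    [Decidable last] [Decidable first'] [Decidable last'] (u : ℕ) (h : first' ↔ first)
    (h' : last' ↔ last ∧ e.tgt ≠ some u) :
    edgeCopies e first' last' =
      (edgeCopies e first last).filter (fun x => x.1 || decide (x.2.tgt ≠ u)) := by
  unfold edgeCopies
  split
  · rfl
  · rename_i w hw
    rw [hw] at h'
    by_cases h1 : first <;> by_cases h2 : last <;> by_cases h3 : w = u <;>
      simp_all

/-- The incremental construction agrees with the description used for the Thompson graph: a new edge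
is the last one into its target, revokes that status from any earlier edge, and is the first one
only if the target had no incoming edge. -/
theorem taggedEdges_eq_flatMap (E : List DiagramEdge) :
    taggedEdges E = (List.finRange E.length).flatMap fun i =>
      edgeCopies E[i] (∀ j : Fin E.length, E[j].tgt = E[i].tgt → i ≤ j)
        (∀ j : Fin E.length, E[j].tgt = E[i].tgt → j ≤ i) := by
  induction E using List.reverseRecOn with
  | nil => simp [taggedEdges]
  | append_singleton E e ih =>
    have hlen : (E ++ [e]).length = E.length + 1 := by simp
    have hex : ∀ u, (∃ x ∈ taggedEdges E, x.2.tgt = u) ↔ ∃ e ∈ E, e.tgt = some u :=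
      fun u => exists_mem_taggedEdges
    have hstep : taggedEdges (E ++ [e]) = insertEdge (taggedEdges E) e := by
      simp [taggedEdges]
    rw [hstep, flatMap_finRange_of_eq_succ hlen]
    have hforall : ∀ Q : Fin (E ++ [e]).length → Prop, (∀ j, Q j) ↔
        (∀ j : Fin E.length, Q (Fin.cast hlen.symm j.castSucc)) ∧
          Q (Fin.cast hlen.symm (Fin.last _)) := by
      intro Q
      rw [← (finCongr hlen.symm).forall_congr_right, Fin.forall_fin_succ']
      rfl
    have hget : ∀ j : Fin E.length, (E ++ [e])[Fin.cast hlen.symm j.castSucc] = E[j] := by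
      intro j
      simp
    have hlast : (E ++ [e])[Fin.cast hlen.symm (Fin.last _)] = e := by simp
    have hle1 : ∀ i j : Fin E.length, Fin.cast hlen.symm i.castSucc ≤ Fin.cast hlen.symm j.castSucc
      ↔ i ≤ j := by intro i j; rfl
    have hle2 : ∀ i : Fin E.length, (Fin.cast hlen.symm i.castSucc ≤
      Fin.cast hlen.symm (Fin.last _)) ↔ True := by
        intro i; simp [Fin.le_def]
    have hle3 : ∀ i : Fin E.length, (Fin.cast hlen.symm (Fin.last _) ≤
      Fin.cast hlen.symm i.castSucc) ↔ False := by
        intro i; simp [Fin.le_def]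
    simp only [hforall, hget, hlast, hle1, hle2, hle3, le_refl, imp_true_iff, and_true, imp_false]
    unfold insertEdge
    split
    · rename_i h
      have hcopies : edgeCopies e (∀ j : Fin E.length, ¬E[j].tgt = e.tgt) True = [] := by
        unfold edgeCopies
        rw [h]
      rw [hcopies, List.append_nil, ih]
      refine congrArg (fun f => List.flatMap f _) (funext fun i => ?_)
      exact edgeCopies_congr _ _ _ _ fun hi =>
        ⟨fun hl => ⟨hl, by rw [h]; exact hi.symm⟩, fun hl => hl.1⟩
    · rename_i u h
      have hcopies : edgeCopies e (∀ j : Fin E.length, ¬E[j].tgt = e.tgt) True =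
          (if ∀ x ∈ taggedEdges E, x.2.tgt ≠ u then [(true, ⟨e.src, u, e.label⟩)] else []) ++
            [(false, ⟨e.src, u, e.label⟩)] := by
        have hiff : (∀ j : Fin E.length, ¬E[j].tgt = some u) ↔
            ∀ x ∈ taggedEdges E, x.2.tgt ≠ u := by
          rw [← not_iff_not]
          push Not
          rw [hex, List.exists_mem_iff_getElem, Fin.exists_iff]
          rfl
        unfold edgeCopies
        rw [h]
        simp only [hiff, if_true]
      rw [hcopies, ih, List.filter_flatMap]
      refine congrArg (· ++ _) (congrArg (fun f => List.flatMap f _) (funext fun i => ?_))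
      exact (filter_edgeCopies _ _ _ _ _ _ Iff.rfl
        (by rw [h]; exact and_congr_right fun _ => not_congr eq_comm)).symm

theorem map_snd_edgeCopies (e : DiagramEdge) (first last : Prop) [Decidable first]
    [Decidable last] :
    (edgeCopies e first last).map Prod.snd =
      match e.tgt with
      | none => []
      | some u => (if first then [⟨e.src, u, e.label⟩] else []) ++
          (if last then [⟨e.src, u, e.label⟩] else []) := by
  unfold edgeCopies
  split
  · rfl
  · split_ifs <;> rfl

theorem GeometricDiagram.map_snd_taggedEdges (G : GeometricDiagram) :
    (taggedEdges G.edges).map Prod.snd = G.thompsonEdges := by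
  rw [taggedEdges_eq_flatMap, List.map_flatMap]
  exact congrArg (fun f => List.flatMap f _) (funext fun i =>
    map_snd_edgeCopies G.edges[i] (G.IsFirst i) (G.IsLast i))

/-! ### Merges, forests and the arcs of their trees -/

/-- `Merges M B w arcs`: the steps `M` are inverse splittings that lead from `w` to `x`.  If the
bottom path with label `w` has the vertices `B`, then `arcs` lists the edges, labeled by the left
letter, between the left and the middle vertex of the cells of `M`. -/
inductive Merges : List Step → List ℕ → Word → List PlaneEdge → Prop
  | nil (a : ℕ) : Merges [] [a] [Letter.x] []
  | cons {M : List Step} {P R : List ℕ} {W₁ W₂ : Word} {arcs : List PlaneEdge} {a : ℕ} (b : ℕ)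
      (t₁ t₂ : Letter) {t : Letter} (hP : P.length = W₁.length) (hR : R.length = W₂.length)
      (h : Merges M (P ++ a :: R) (W₁ ++ t :: W₂) arcs) :
      Merges (⟨W₁, .merge t₁ t₂ t, W₂⟩ :: M) (P ++ a :: b :: R) (W₁ ++ t₁ :: t₂ :: W₂)
        (⟨a, b, t₁⟩ :: arcs)

namespace Merges

variable {M : List Step} {B : List ℕ} {w : Word} {arcs : List PlaneEdge}

theorem length_eq (h : Merges M B w arcs) : B.length = w.length := by
  cases h <;> simp [*]

theorem arcs_spec {p : ℕ → ℕ} (h : Merges M B w arcs) (hB : B.Pairwise (fun u v => p u < p v)) :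
    ∀ e ∈ arcs, e.src ∈ B ∧ e.tgt ∈ B ∧ p e.src < p e.tgt := by
  induction h with
  | nil a => simp
  | @cons M P R W₁ W₂ arcs a b t₁ t₂ t hP hR h ih =>
    have hsub : (P ++ a :: R).Sublist (P ++ a :: b :: R) := by simp
    intro e he
    rcases List.mem_cons.1 he with rfl | he
    · simp only [List.pairwise_append, List.pairwise_cons, List.mem_cons] at hB
      simp only [List.mem_append, List.mem_cons, true_or, or_true, true_and]
      exact hB.2.1.1 b (Or.inl rfl)
    · obtain ⟨h1, h2, h3⟩ := ih (hB.sublist hsub) e he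
      exact ⟨hsub.subset h1, hsub.subset h2, h3⟩

/-- Splittings only replace a leaf by two leaves, so no trees have grown above the peak. -/
theorem foldl_treeStep_inv (h : Merges M B w arcs) :
    (M.reverse.map Step.inv).foldl treeStep [LabeledTree.leaf] =
      List.replicate B.length LabeledTree.leaf := by
  induction h with
  | nil a => rfl
  | @cons M P R W₁ W₂ arcs a b t₁ t₂ t hP hR h ih =>
    have h1 : List.replicate (P ++ a :: R).length LabeledTree.leaf =
        List.replicate P.length LabeledTree.leaf ++ LabeledTree.leaf ::
          List.replicate R.length LabeledTree.leaf := by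
      rw [List.length_append, List.replicate_add]
      rfl
    have h2 : List.replicate (P ++ a :: b :: R).length LabeledTree.leaf =
        List.replicate P.length LabeledTree.leaf ++ LabeledTree.leaf :: LabeledTree.leaf ::
          List.replicate R.length LabeledTree.leaf := by
      rw [List.length_append, List.replicate_add]
      rfl
    rw [List.reverse_cons, List.map_append, List.foldl_append, ih, h1, h2]
    simp [treeStep, Step.inv, Cell.inv, ← hP]

end Merges

/-- The arcs across the left edges of a forest. -/
def forestArcs : List LabeledTree → ℕ → List PlaneEdge
  | [], _ => []
  | A :: F, o => A.leftArcs o ++ forestArcs F (o + A.numLeaves)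

/-- The integers to the left of the trees of a forest. -/
def forestStarts : List LabeledTree → ℕ → List ℕ
  | [], _ => []
  | A :: F, o => o :: forestStarts F (o + A.numLeaves)

def forestLeaves (F : List LabeledTree) : ℕ := (F.map LabeledTree.numLeaves).sum

theorem forestArcs_append (F F' : List LabeledTree) (o : ℕ) :
    forestArcs (F ++ F') o = forestArcs F o ++ forestArcs F' (o + forestLeaves F) := by
  induction F generalizing o with
  | nil => simp [forestArcs, forestLeaves]
  | cons A F ih => simp [forestArcs, forestLeaves, ih, add_assoc]

theorem forestStarts_append (F F' : List LabeledTree) (o : ℕ) :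
    forestStarts (F ++ F') o = forestStarts F o ++ forestStarts F' (o + forestLeaves F) := by
  induction F generalizing o with
  | nil => simp [forestStarts, forestLeaves]
  | cons A F ih => simp [forestStarts, forestLeaves, ih, add_assoc]

theorem length_forestStarts (F : List LabeledTree) (o : ℕ) :
    (forestStarts F o).length = F.length := by
  induction F generalizing o with
  | nil => rfl
  | cons A F ih => simp [forestStarts, ih]

theorem forestArcs_replicate_leaf (n o : ℕ) :
    forestArcs (List.replicate n LabeledTree.leaf) o = [] := by
  induction n generalizing o with
  | zero => rfl
  | succ n ih => simp [List.replicate_succ, forestArcs, LabeledTree.leftArcs, ih]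

theorem forestStarts_replicate_leaf (n o : ℕ) :
    forestStarts (List.replicate n LabeledTree.leaf) o = List.range' o n := by
  induction n generalizing o with
  | zero => rfl
  | succ n ih =>
    simp [List.replicate_succ, forestStarts, LabeledTree.numLeaves, ih, List.range'_succ]

theorem forestLeaves_replicate_leaf (n : ℕ) :
    forestLeaves (List.replicate n LabeledTree.leaf) = n := by
  simp [forestLeaves, LabeledTree.numLeaves]

theorem exists_append_of_length_eq {α β : Type*} {F : List α} {P Q : List β}
    (h : F.length = (P ++ Q).length) :
    ∃ F₁ F₂, F = F₁ ++ F₂ ∧ F₁.length = P.length ∧ F₂.length = Q.length :=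
  ⟨F.take P.length, F.drop P.length, (List.take_append_drop _ _).symm,
    by simp at h ⊢; omega, by simp at h ⊢; omega⟩

/-- A merge joins adjacent trees `A` and `A'` under a new root and adds one arc, from the start of
`A` to the start of `A'`. These starts are `p a` and `p b`, so the arc is the renumbered edge `a →
b`. Starts of the remaining trees do not move, so the hypothesis persists. -/
theorem Merges.foldl_treeStep {M : List Step} {B : List ℕ} {w : Word} {arcs : List PlaneEdge}
    {p : ℕ → ℕ} (h : Merges M B w arcs) (F : List LabeledTree) (hF : B.map p = forestStarts F 0) :
    ∃ T, M.foldl treeStep F = [T] ∧ T.numLeaves = forestLeaves F ∧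
      (T.leftArcs 0).Perm (arcs.map (PlaneEdge.relabel p) ++ forestArcs F 0) := by
  induction h generalizing F with
  | nil a =>
    have hlen := congrArg List.length hF
    rw [length_forestStarts] at hlen
    obtain ⟨T, rfl⟩ := List.length_eq_one_iff.1 hlen.symm
    exact ⟨T, rfl, by simp [forestLeaves], by simp [forestArcs]⟩
  | @cons M P R W₁ W₂ arcs a b t₁ t₂ t hP hR h ih =>
    have hlen := congrArg List.length hF
    rw [length_forestStarts, List.length_map] at hlen
    obtain ⟨F₁, F₂, rfl, h1, h2⟩ := exists_append_of_length_eq hlen.symm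
    match F₂, h2 with
    | A :: A' :: F₂, h2 =>
      rw [forestStarts_append, List.map_append] at hF
      obtain ⟨hF1, hF2⟩ := List.append_inj hF (by simp [length_forestStarts, h1])
      simp only [List.map_cons, forestStarts, List.cons.injEq] at hF2
      obtain ⟨ha, hb, hF2⟩ := hF2
      obtain ⟨T, hT, hn, hp⟩ := ih (F₁ ++ LabeledTree.node t₁ A t₂ A' :: F₂) (by
        rw [forestStarts_append, List.map_append, hF1]
        simp only [List.map_cons, forestStarts, LabeledTree.numLeaves, ha, hF2, add_assoc])
      refine ⟨T, ?_, ?_, hp.trans ?_⟩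
      · rw [List.foldl_cons, ← hT]
        simp [treeStep, ← hP, ← h1]
      · rw [hn]
        simp [forestLeaves, LabeledTree.numLeaves, add_assoc]
      · rw [forestArcs_append, forestArcs_append, List.map_cons, List.cons_append]
        simp only [forestArcs, LabeledTree.leftArcs, LabeledTree.numLeaves, List.cons_append,
          List.append_assoc, ← add_assoc, PlaneEdge.relabel, ha, hb]
        rw [← List.append_assoc]
        refine List.perm_middle.trans ?_
        rw [List.append_assoc]

theorem Step.inv_inv (s : Step) : s.inv.inv = s := by
  obtain ⟨P, c, R⟩ := s
  cases c <;> rfl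

/-- If `S` consists of splittings that lead to the peak, where `p` numbers the bottom path `B` from
left to right, then the tree of `S ++ M` is the one of `M`. -/
theorem Merges.bottomTree_spec {S M : List Step} {B : List ℕ} {w : Word}
    {arcs arcs' : List PlaneEdge} {p : ℕ → ℕ} (hS : Merges (S.reverse.map Step.inv) B w arcs')
    (hM : Merges M B w arcs) (hp : B.map p = List.range B.length) :
    (bottomTree (S ++ M)).numLeaves = B.length ∧
      ((bottomTree (S ++ M)).leftArcs 0).Perm (arcs.map (PlaneEdge.relabel p)) := by
  have hS' := hS.foldl_treeStep_inv
  rw [← List.map_reverse, List.reverse_reverse, List.map_map,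
    show Step.inv ∘ Step.inv = id from funext Step.inv_inv, List.map_id] at hS'
  obtain ⟨T, hT, hn, hperm⟩ := hM.foldl_treeStep (List.replicate B.length LabeledTree.leaf)
    (by rw [hp, forestStarts_replicate_leaf, List.range_eq_range'])
  rw [bottomTree, List.foldl_append, hS', hT, List.headD_cons]
  refine ⟨hn.trans (forestLeaves_replicate_leaf _), ?_⟩
  rwa [forestArcs_replicate_leaf, List.append_nil] at hperm

namespace LabeledTree

theorem leftArcs_bounds (t : LabeledTree) (o : ℕ) :
    ∀ e ∈ t.leftArcs o, o ≤ e.src ∧ e.src < e.tgt ∧ e.tgt < o + t.numLeaves := by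
  induction t generalizing o with
  | leaf => simp [leftArcs]
  | node l A r B ihA ihB =>
    intro e he
    have hA := A.numLeaves_pos
    have hB := B.numLeaves_pos
    simp only [leftArcs, List.mem_cons, List.mem_append] at he
    simp only [numLeaves]
    rcases he with rfl | he | he
    · dsimp only
      omega
    · have := ihA o e he
      omega
    · have := ihB _ e he
      omega

/-- The target of an arc is the integer that separates the leaves of the left and right subtrees of
its node, and distinct nodes have distinct such integers. Arcs with a common source are nested, the
outer one being listed first. -/
theorem pairwise_leftArcs (t : LabeledTree) (o : ℕ) :
    (t.leftArcs o).Pairwise (fun e e' => e.tgt ≠ e'.tgt ∧ (e.src = e'.src → e'.tgt < e.tgt)) := by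
  induction t generalizing o with
  | leaf => simp [leftArcs]
  | node l A r B ihA ihB =>
    simp only [leftArcs, List.pairwise_cons, List.mem_append, List.pairwise_append]
    refine ⟨?_, ihA o, ihB _, ?_⟩
    · rintro e (he | he)
      · have := A.leftArcs_bounds o e he
        omega
      · have := B.leftArcs_bounds _ e he
        have := A.numLeaves_pos
        omega
    · intro e he e' he'
      have := A.leftArcs_bounds _ e he
      have := B.leftArcs_bounds _ e' he'
      omega

theorem head_leftArcs_src (t : LabeledTree) (o : ℕ) : ∀ e ∈ (t.leftArcs o).head?, e.src = o := by
  cases t <;> simp [leftArcs]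

end LabeledTree

theorem pairwise_above_gamma (Tp Tm : LabeledTree) :
    ((Tp.leftArcs 0).map (Prod.mk true) ++
      (Tm.leftArcs 0).reverse.map (Prod.mk false)).Pairwise Above := by
  rw [List.pairwise_append, List.pairwise_map, List.pairwise_map, List.pairwise_reverse]
  refine ⟨(Tp.pairwise_leftArcs 0).imp fun h => ?_, (Tm.pairwise_leftArcs 0).imp fun h => ?_, ?_⟩
  · exact ⟨fun e => absurd e h.1, fun e => Or.inr (Or.inl ⟨rfl, rfl, h.2 e⟩)⟩
  · exact ⟨fun e => absurd e.symm h.1, fun e => Or.inr (Or.inr ⟨rfl, rfl, h.2 e.symm⟩)⟩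
  · intro x hx y hy
    obtain ⟨_, _, rfl⟩ := List.mem_map.1 hx
    obtain ⟨_, _, rfl⟩ := List.mem_map.1 hy
    exact ⟨fun _ => ⟨rfl, rfl⟩, fun _ => Or.inl ⟨rfl, rfl⟩⟩

/-! ### Edges of the bottom path -/

/-- The edges of the bottom path with vertices `B` and label `w` that lead to inner vertices. -/
def pathEdges : List ℕ → Word → List PlaneEdge
  | a :: b :: B, l :: w => ⟨a, b, l⟩ :: pathEdges (b :: B) w
  | _, _ => []

theorem pathEdges_append_cons (P R : List ℕ) (a : ℕ) (W₁ W : Word) (h : P.length = W₁.length) :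
    pathEdges (P ++ a :: R) (W₁ ++ W) = pathEdges (P ++ [a]) W₁ ++ pathEdges (a :: R) W := by
  induction P generalizing W₁ with
  | nil =>
    obtain rfl : W₁ = [] := List.length_eq_zero_iff.1 h.symm
    simp [pathEdges]
  | cons c P ih =>
    match W₁, h with
    | l :: W₁, h =>
      have := ih W₁ (by simpa using h)
      match P with
      | [] => simpa [pathEdges] using this
      | d :: P => simpa [pathEdges] using this

theorem pathEdges_spec {B : List ℕ} {W : Word} {e : PlaneEdge} (he : e ∈ pathEdges B W) :
    e.src ∈ B.dropLast ∧ e.tgt ∈ B.tail := by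
  induction B generalizing W with
  | nil => simp [pathEdges] at he
  | cons a B ih =>
    match B, W with
    | [], W => simp [pathEdges] at he
    | b :: B, [] => simp [pathEdges] at he
    | b :: B, l :: W =>
      simp only [pathEdges, List.mem_cons] at he
      rcases he with rfl | he
      · simp
      · have := ih he
        simp only [List.dropLast_cons_cons, List.tail_cons, List.mem_cons] at this ⊢
        exact ⟨Or.inr this.1, Or.inr this.2⟩

theorem pathEdges_cons_cons (a : ℕ) (R : List ℕ) (l : Letter) (W : Word) :
    pathEdges (a :: R) (l :: W) =
      R.head?.toList.map (fun c => ⟨a, c, l⟩) ++ pathEdges R W := by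
  cases R <;> simp [pathEdges]

theorem eq_nil_of_pathEdges_eq_nil {P : List ℕ} {a : ℕ} {W : Word} (h : P.length = W.length)
    (h' : pathEdges (P ++ [a]) W = []) : P = [] := by
  match P, W, h with
  | [], _, _ => rfl
  | [b], l :: W, _ => simp [pathEdges] at h'
  | b :: c :: P, l :: W, _ => simp [pathEdges] at h'

/-- The vertices of the path are distinct, so excluding the head of `R` as a target deletes just the
edge from `a`. If `R` is empty, that edge leads to the terminal vertex and was never listed. This is
the effect of a new last edge into the vertex after `a`. -/
theorem mem_pathEdges_and_ne_head {P R : List ℕ} {a : ℕ} {W₁ W₂ : Word} {l : Letter}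
    {e : PlaneEdge} (hB : (P ++ a :: R).Nodup) (hP : P.length = W₁.length) :
    (e ∈ pathEdges (P ++ a :: R) (W₁ ++ l :: W₂) ∧ some e.tgt ≠ R.head?) ↔
      e ∈ pathEdges (P ++ [a]) W₁ ∨ e ∈ pathEdges R W₂ := by
  rw [pathEdges_append_cons _ _ _ _ _ hP, pathEdges_cons_cons]
  have h1 : e ∈ pathEdges (P ++ [a]) W₁ → some e.tgt ≠ R.head? := by
    intro he h
    have h1 := List.mem_of_mem_tail (pathEdges_spec he).2
    have h2 := List.mem_of_mem_head? h.symm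
    rw [List.append_cons, List.nodup_append] at hB
    exact hB.2.2 _ h1 _ h2 rfl
  have h2 : e ∈ pathEdges R W₂ → some e.tgt ≠ R.head? := by
    intro he h
    have h1 := (pathEdges_spec he).2
    match R, h with
    | c :: R, h =>
      simp only [List.nodup_append, List.nodup_cons, List.tail_cons, List.head?_cons,
        Option.some.injEq] at hB h h1
      exact hB.2.1.2.1 (h ▸ h1)
  have h3 : e ∈ R.head?.toList.map (fun c => (⟨a, c, l⟩ : PlaneEdge)) →
      some e.tgt = R.head? := by
    rw [List.mem_map]
    rintro ⟨c, hc, rfl⟩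
    simpa [eq_comm] using hc
  rw [List.mem_append, List.mem_append]
  tauto

theorem insertEdge_of_exists {T : List (Bool × PlaneEdge)} {a : ℕ} {c : Option ℕ} {l : Letter}
    (h : ∀ u ∈ c, ∃ x ∈ T, x.2.tgt = u) :
    insertEdge T ⟨a, c, l⟩ =
      T.filter (fun x => x.1 || decide (some x.2.tgt ≠ c)) ++
        c.toList.map (fun u => (false, ⟨a, u, l⟩)) := by
  match c, h with
  | none, _ => simp [insertEdge]
  | some c, h =>
    have : ¬ ∀ x ∈ T, x.2.tgt ≠ c := by push Not; exact h c rfl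
    simp only [insertEdge, if_neg this, List.nil_append, Option.toList_some, List.map_cons,
      List.map_nil, ne_eq, Option.some.injEq]

theorem insertEdge_of_forall {T : List (Bool × PlaneEdge)} {a c : ℕ} {l : Letter}
    (h : ∀ x ∈ T, x.2.tgt ≠ c) :
    insertEdge T ⟨a, some c, l⟩ = T ++ [(true, ⟨a, c, l⟩), (false, ⟨a, c, l⟩)] := by
  have h' : T.filter (fun x => x.1 || decide (x.2.tgt ≠ c)) = T :=
    List.filter_eq_self.2 fun x hx => by simp [h x hx]
  simp only [insertEdge, if_pos h, h', List.cons_append, List.nil_append]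

theorem taggedEdges_append (E E' : List DiagramEdge) :
    taggedEdges (E ++ E') = E'.foldl insertEdge (taggedEdges E) :=
  List.foldl_append

/-! ### The splittings before the peak -/

/-- The invariants of a diagram that consists of the splittings `S`: its bottom path is labeled `w`,
and `arcs` are the first incoming edges of its inner vertices. -/
structure SplitInv (S : List Step) (G : GeometricDiagram) (w : Word) (arcs : List PlaneEdge) :
    Prop where
  merges : Merges (S.reverse.map Step.inv) G.bottom w arcs
  perm : G.bottom.Perm (List.range G.numVertices)
  head : G.bottom.head? = some 0
  mem_true : ∀ e, (true, e) ∈ taggedEdges G.edges ↔ e ∈ arcs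
  mem_false : ∀ e, (false, e) ∈ taggedEdges G.edges ↔ e ∈ pathEdges G.bottom w
  -- The numbering is only known at the peak; hence the claim is made for every numbering that
  -- increases along the current bottom path. One that increases along a later bottom path does so
  -- along the present one, which is a sublist.
  pairwise : ∀ p : ℕ → ℕ, G.bottom.Pairwise (fun u v => p u < p v) →
    ((taggedEdges G.edges).map (Prod.map id (PlaneEdge.relabel p))).Pairwise Above
  head_tagged : ∀ x ∈ (taggedEdges G.edges).head?, x.1 = true ∧ x.2.src = 0

theorem splitInv_trivial : SplitInv [] GeometricDiagram.trivial [Letter.x] [] where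
  merges := Merges.nil 0
  perm := by simp [GeometricDiagram.trivial]
  head := rfl
  mem_true e := by simp [GeometricDiagram.trivial, taggedEdges, insertEdge]
  mem_false e := by simp [GeometricDiagram.trivial, taggedEdges, insertEdge, pathEdges]
  pairwise p _ := by simp [GeometricDiagram.trivial, taggedEdges, insertEdge]
  head_tagged := by simp [GeometricDiagram.trivial, taggedEdges, insertEdge]

theorem pairwise_idxOf_lt {B : List ℕ} (hB : B.Nodup) :
    B.Pairwise (fun u v => B.idxOf u < B.idxOf v) := by
  rw [List.pairwise_iff_getElem]
  intro i j hi hj hij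
  rwa [hB.idxOf_getElem, hB.idxOf_getElem]

theorem attach_split {G : GeometricDiagram} {P R : List ℕ} {a : ℕ} {W₁ W₂ : Word}
    {s t₁ t₂ : Letter} (hB : G.bottom = P ++ a :: R) (hP : P.length = W₁.length) :
    G.attach ⟨W₁, .split s t₁ t₂, W₂⟩ =
      ⟨G.numVertices + 1, G.edges ++ [⟨a, some G.numVertices, t₁⟩, ⟨G.numVertices, R.head?, t₂⟩],
        P ++ a :: G.numVertices :: R⟩ := by
  simp [GeometricDiagram.attach, hB, ← hP]

theorem attach_merge {G : GeometricDiagram} {P R : List ℕ} {a b : ℕ} {W₁ W₂ : Word}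
    {t₁ t₂ t : Letter} (hB : G.bottom = P ++ a :: b :: R) (hP : P.length = W₁.length) :
    G.attach ⟨W₁, .merge t₁ t₂ t, W₂⟩ =
      ⟨G.numVertices, G.edges ++ [⟨a, R.head?, t⟩], P ++ a :: R⟩ := by
  simp [GeometricDiagram.attach, hB, ← hP]

/-- The first entry has tag `true`, so it survives the deletion of superseded last edges. -/
theorem forall_head_append {T T' : List (Bool × PlaneEdge)} {q : PlaneEdge → Bool}
    (h : ∀ x ∈ T.head?, x.1 = true ∧ x.2.src = 0)
    (h' : T = [] → ∀ x ∈ T'.head?, x.1 = true ∧ x.2.src = 0) :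
    ∀ x ∈ (T.filter (fun x => x.1 || q x.2) ++ T').head?, x.1 = true ∧ x.2.src = 0 := by
  match T, h with
  | [], _ => simpa using h' rfl
  | (b, x) :: T, h =>
    obtain ⟨hb, hx⟩ := h _ rfl
    simp only at hb hx
    subst hb
    simp [hx]

/-- The new vertex receives one edge, which is both first and last and hence doubled. The second
edge of the cell supersedes the old bottom edge from `a` as last edge into the next vertex, if that
is an inner one. -/
theorem SplitInv.taggedEdges_attach {S : List Step} {G : GeometricDiagram} {arcs : List PlaneEdge}
    {P R : List ℕ} {a : ℕ} {W₁ W₂ : Word} {s t₁ t₂ : Letter}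
    (h : SplitInv S G (W₁ ++ s :: W₂) arcs)
    (hB : G.bottom = P ++ a :: R) (hP : P.length = W₁.length) :
    taggedEdges (G.attach ⟨W₁, .split s t₁ t₂, W₂⟩).edges =
      (taggedEdges G.edges).filter (fun x => x.1 || decide (some x.2.tgt ≠ R.head?)) ++
        ((true, ⟨a, G.numVertices, t₁⟩) :: (false, ⟨a, G.numVertices, t₁⟩) ::
          R.head?.toList.map (fun c => (false, ⟨G.numVertices, c, t₂⟩))) := by
  have hlt : ∀ u ∈ G.bottom, u < G.numVertices := fun u hu => by
    simpa using h.perm.mem_iff.1 hu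
  have hnew : ∀ x ∈ taggedEdges G.edges, x.2.tgt ≠ G.numVertices := by
    rintro ⟨b, x⟩ hx
    refine (hlt _ ?_).ne
    cases b
    · exact List.mem_of_mem_tail (pathEdges_spec ((h.mem_false x).1 hx)).2
    · exact (h.merges.arcs_spec (pairwise_idxOf_lt (h.perm.nodup_iff.2 List.nodup_range)) x ((h.mem_true x).1 hx)).2.1
  have hR : ∀ u ∈ R.head?, u ≠ G.numVertices := fun u hu =>
    (hlt u (by rw [hB]; simp [List.mem_of_mem_head? hu])).ne
  rw [attach_split hB hP, taggedEdges_append, List.foldl_cons, List.foldl_cons, List.foldl_nil,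
    insertEdge_of_forall hnew, insertEdge_of_exists, List.filter_append, List.append_assoc]
  · congr 1
    have : some G.numVertices ≠ R.head? := fun e => hR _ e.symm rfl
    simp [this]
  · intro c hc
    refine ⟨(false, ⟨a, c, s⟩), List.mem_append_left _ ((h.mem_false _).2 ?_), rfl⟩
    rw [hB, pathEdges_append_cons _ _ _ _ _ hP, pathEdges_cons_cons]
    simp [Option.mem_def.1 hc]

theorem SplitInv.attach {S : List Step} {G : GeometricDiagram} {arcs : List PlaneEdge}
    {W₁ W₂ : Word} {s t₁ t₂ : Letter} (h : SplitInv S G (W₁ ++ s :: W₂) arcs) :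
    ∃ arcs', SplitInv (S ++ [⟨W₁, .split s t₁ t₂, W₂⟩]) (G.attach ⟨W₁, .split s t₁ t₂, W₂⟩)
      (W₁ ++ t₁ :: t₂ :: W₂) arcs' := by
  obtain ⟨P, F, hB, hP, hF⟩ := exists_append_of_length_eq h.merges.length_eq
  match F, hF with
  | a :: R, hF =>
  have hR : R.length = W₂.length := by simpa using hF
  have hT := h.taggedEdges_attach (t₁ := t₁) (t₂ := t₂) hB hP
  have hG := attach_split (s := s) (t₁ := t₁) (t₂ := t₂) (W₂ := W₂) hB hP
  have hbot : (G.attach ⟨W₁, .split s t₁ t₂, W₂⟩).bottom = P ++ a :: G.numVertices :: R := by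
    rw [hG]
  have hnum : (G.attach ⟨W₁, .split s t₁ t₂, W₂⟩).numVertices = G.numVertices + 1 := by rw [hG]
  have hnodup : (P ++ a :: R).Nodup := hB ▸ h.perm.nodup_iff.2 List.nodup_range
  have hmem_false := fun e => (and_congr_left' (h.mem_false e)).trans
    (hB ▸ mem_pathEdges_and_ne_head (l := s) (W₂ := W₂) (e := e) hnodup hP)
  refine ⟨⟨a, G.numVertices, t₁⟩ :: arcs, ?_, ?_, ?_, ?_, ?_, ?_, ?_⟩
  · rw [hbot, List.reverse_append, List.reverse_singleton, List.singleton_append, List.map_cons]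
    exact Merges.cons _ _ _ hP hR (hB ▸ h.merges)
  · rw [hbot, hnum, List.range_succ]
    have := h.perm
    rw [hB] at this
    rw [List.append_cons]
    refine List.perm_middle.trans ?_
    rw [← List.append_cons]
    exact (this.cons _).trans (List.perm_append_singleton _ _).symm
  · have := h.head
    rw [hB] at this
    rw [hbot]
    cases P <;> simpa using this
  · intro e
    rw [hT]
    simp [h.mem_true, or_comm]
  · intro e
    rw [hT, hbot, pathEdges_append_cons _ _ _ _ _ hP, pathEdges_cons_cons, pathEdges_cons_cons]
    have := hmem_false e
    simp only [List.mem_append, List.mem_filter, List.mem_cons, List.mem_map, Prod.mk.injEq,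
      Bool.false_or, decide_eq_true_eq, List.head?_cons, Option.toList_some, List.map_cons,
      List.map_nil, this, Bool.false_eq_true, false_and, true_and, false_or, List.not_mem_nil,
      or_false]
    clear * -
    grind
  · intro p hp
    rw [hbot] at hp
    have hsub : (P ++ a :: R).Sublist (P ++ a :: G.numVertices :: R) := by simp
    have hB' : G.bottom.Pairwise (fun u v => p u < p v) := hB ▸ hp.sublist hsub
    have htrue : ∀ x : PlaneEdge, (true, x) ∈ taggedEdges G.edges →
        x.src ∈ P ++ a :: R ∧ x.tgt ∈ P ++ a :: R ∧ p x.src < p x.tgt := fun x hx =>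
      hB ▸ h.merges.arcs_spec hB' x ((h.mem_true x).1 hx)
    -- A surviving last edge lies on the bottom path strictly to one side of the replaced edge, so
    -- it shares no end point with the new cell that would matter for the order.
    have hfalse : ∀ x : PlaneEdge, (false, x) ∈ taggedEdges G.edges → some x.tgt ≠ R.head? →
        (x.src ∈ P ∧ x.tgt ∈ P ++ [a]) ∨ (x.src ∈ R ∧ x.tgt ∈ R.tail) := by
      intro x hx hx'
      rcases (hmem_false x).1 ⟨hx, hx'⟩ with hx | hx
      · have := pathEdges_spec hx
        rw [List.dropLast_concat] at this
        exact Or.inl ⟨this.1, List.mem_of_mem_tail this.2⟩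
      · exact Or.inr ⟨List.mem_of_mem_dropLast (pathEdges_spec hx).1, (pathEdges_spec hx).2⟩
    have hpair := h.pairwise p hB'
    rw [hT]
    rw [List.pairwise_map] at hpair ⊢
    simp only [List.pairwise_append, List.pairwise_cons, List.mem_cons] at hp
    obtain ⟨-, ⟨haR, hnR, hRp⟩, hPR⟩ := hp
    have han := haR _ (Or.inl rfl)
    replace haR := fun u hu => haR u (Or.inr hu)
    have hPa := fun u hu => hPR u hu a (Or.inl rfl)
    have hPn := fun u hu => hPR u hu _ (Or.inr (Or.inl rfl))
    replace hPR := fun u hu v hv => hPR u hu v (Or.inr (Or.inr hv))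
    have hcR : ∀ c ∈ R.head?, c ∈ R := fun c hc => List.mem_of_mem_head? hc
    rw [List.pairwise_append]
    refine ⟨hpair.filter _, ?_, ?_⟩
    · simp only [List.pairwise_cons, List.mem_cons, List.mem_map, Option.mem_toList]
      refine ⟨?_, ?_, ?_⟩
      · rintro y (rfl | ⟨c, hc, rfl⟩)
        · exact ⟨fun _ => ⟨rfl, rfl⟩, fun _ => Or.inl ⟨rfl, rfl⟩⟩
        · exact ⟨fun _ => ⟨rfl, rfl⟩, fun _ => Or.inl ⟨rfl, rfl⟩⟩
      · rintro y ⟨c, hc, rfl⟩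
        exact ⟨fun e => absurd e (hnR c (hcR c hc)).ne, fun e => absurd e han.ne⟩
      · cases R.head? <;> simp
    · rintro ⟨b, x⟩ hx y hy
      simp only [List.mem_filter, Bool.or_eq_true, decide_eq_true_eq] at hx
      obtain ⟨hx, hx'⟩ := hx
      cases b
      · have hx := hfalse x hx (by simpa using hx')
        have h1 : p x.tgt ≠ p G.numVertices ∧ p x.src ≠ p a ∧ p x.src ≠ p G.numVertices := by
          rcases hx with ⟨hs, ht⟩ | ⟨hs, ht⟩
          · have := hPa _ hs
            rcases List.mem_append.1 ht with ht | ht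
            · have := hPn _ ht
              have := hPn _ hs
              omega
            · obtain rfl := List.mem_singleton.1 ht
              omega
          · have := hnR _ hs
            have := hnR _ (List.mem_of_mem_tail ht)
            omega
        have h2 : ∀ c ∈ R.head?, p x.tgt ≠ p c := by
          intro c hc
          rcases hx with ⟨hs, ht⟩ | ⟨hs, ht⟩
          · rcases List.mem_append.1 ht with ht | ht
            · exact (hPR _ ht _ (hcR c hc)).ne
            · obtain rfl := List.mem_singleton.1 ht
              exact (haR _ (hcR c hc)).ne
          · match R, hc, ht, hRp with
            | d :: R, hc, ht, hRp =>
              obtain rfl : d = c := by simpa using hc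
              exact ((List.pairwise_cons.1 hRp).1 _ ht).ne'
        simp only [List.mem_cons, List.mem_map, Option.mem_toList] at hy
        rcases hy with rfl | rfl | ⟨c, hc, rfl⟩
        · exact ⟨fun e => absurd e h1.1, fun e => absurd e h1.2.1⟩
        · exact ⟨fun e => absurd e h1.1, fun e => absurd e h1.2.1⟩
        · exact ⟨fun e => absurd e (h2 c hc), fun e => absurd e h1.2.2⟩
      · simp only [List.mem_cons, List.mem_map, Option.mem_toList] at hy
        rcases hy with rfl | rfl | ⟨c, hc, rfl⟩
        -- An older first edge out of `a` ends at an old bottom vertex to the right of `a`, hence to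
        -- the right of the new vertex: it runs above the new arc.
        · obtain ⟨-, ht, hlt⟩ := htrue x hx
          rw [List.mem_append, List.mem_cons] at ht
          have h1 : p x.tgt ≠ p G.numVertices ∧ (p x.src = p a → p G.numVertices < p x.tgt) := by
            rcases ht with ht | ht | ht
            · have := hPn _ ht
              have := hPa _ ht
              omega
            · rw [ht] at hlt ⊢
              omega
            · have := hnR _ ht
              omega
          exact ⟨fun e => absurd e h1.1, fun e => Or.inr (Or.inl ⟨rfl, rfl, h1.2 e⟩)⟩
        · exact ⟨fun _ => ⟨rfl, rfl⟩, fun _ => Or.inl ⟨rfl, rfl⟩⟩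
        · exact ⟨fun _ => ⟨rfl, rfl⟩, fun _ => Or.inl ⟨rfl, rfl⟩⟩
  · rw [hT]
    refine forall_head_append (q := fun e => decide (some e.tgt ≠ R.head?)) h.head_tagged ?_
    -- With no tagged edges yet, no bottom edge leads to an inner vertex, so `P` is empty and `a` is
    -- the initial vertex `0`.
    intro hnil
    have : P = [] := by
      refine eq_nil_of_pathEdges_eq_nil (a := a) hP (List.eq_nil_iff_forall_not_mem.2 fun e he => ?_)
      have := (h.mem_false e).2 (by
        rw [hB, pathEdges_append_cons _ _ _ _ _ hP]
        exact List.mem_append_left _ he)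
      simp [hnil] at this
    have hh := h.head
    rw [hB, this] at hh
    simpa using hh

/-! ### The merges after the peak -/

/-- The invariants of a diagram whose last steps are inverse splittings: its bottom path is labeled
`w`, the first incoming edges are `first`, and `done` are the last incoming edges of the vertices
above the bottom path. -/
structure MergeInv (p : ℕ → ℕ) (G : GeometricDiagram) (w : Word) (first done : List PlaneEdge) :
    Prop where
  sorted : G.bottom.Pairwise (fun u v => p u < p v)
  mem_true : ∀ e, (true, e) ∈ taggedEdges G.edges ↔ e ∈ first
  mem_false : ∀ e, (false, e) ∈ taggedEdges G.edges ↔ e ∈ pathEdges G.bottom w ∨ e ∈ done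
  -- No remaining bottom vertex lies beyond the source of a finished edge without lying beyond its
  -- target. So a later edge from the same source reaches further right, as the order of last edges
  -- requires, and no later edge ends at the target of a finished one.
  done_spec : ∀ e ∈ done, p e.src < p e.tgt ∧ ∀ c ∈ G.bottom, p e.src < p c → p e.tgt < p c
  pairwise : ((taggedEdges G.edges).map (Prod.map id (PlaneEdge.relabel p))).Pairwise Above
  head_tagged : ∀ x ∈ (taggedEdges G.edges).head?, x.1 = true ∧ x.2.src = 0

theorem SplitInv.mergeInv {S : List Step} {G : GeometricDiagram} {w : Word}
    {arcs : List PlaneEdge} (h : SplitInv S G w arcs) {p : ℕ → ℕ}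
    (hp : G.bottom.Pairwise (fun u v => p u < p v)) : MergeInv p G w arcs [] where
  sorted := hp
  mem_true := h.mem_true
  mem_false e := by simp [h.mem_false]
  done_spec := by simp
  pairwise := h.pairwise p hp
  head_tagged := h.head_tagged

theorem MergeInv.attach {p : ℕ → ℕ} {G : GeometricDiagram} {first done : List PlaneEdge}
    {P R : List ℕ} {a b : ℕ} {W₁ W₂ : Word} {t₁ t₂ t : Letter}
    (h : MergeInv p G (W₁ ++ t₁ :: t₂ :: W₂) first done)
    (hB : G.bottom = P ++ a :: b :: R) (hP : P.length = W₁.length) :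
    MergeInv p (G.attach ⟨W₁, .merge t₁ t₂ t, W₂⟩) (W₁ ++ t :: W₂) first
      (⟨a, b, t₁⟩ :: done) := by
  have hG := attach_merge (t₁ := t₁) (t₂ := t₂) (t := t) (W₂ := W₂) hB hP
  have hbot : (G.attach ⟨W₁, .merge t₁ t₂ t, W₂⟩).bottom = P ++ a :: R := by rw [hG]
  have hsub : (P ++ a :: R).Sublist (P ++ a :: b :: R) := by simp
  have hp := h.sorted
  have hnodup : (P ++ [a] ++ b :: R).Nodup := by
    rw [← List.append_cons, ← hB]
    exact List.Pairwise.imp (S := (· ≠ ·)) (fun h e => (e ▸ h).false) hp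
  have hP' : (P ++ [a]).length = (W₁ ++ [t₁]).length := by simp [hP]
  have hpath : pathEdges G.bottom (W₁ ++ t₁ :: t₂ :: W₂) =
      pathEdges (P ++ [a] ++ b :: R) (W₁ ++ [t₁] ++ t₂ :: W₂) := by
    rw [hB, ← List.append_cons, ← List.append_cons]
  have hpath' : pathEdges (P ++ [a] ++ [b]) (W₁ ++ [t₁]) =
      pathEdges (P ++ [a]) W₁ ++ [⟨a, b, t₁⟩] := by
    rw [← List.append_cons, pathEdges_append_cons _ _ _ _ _ hP]
    rfl
  have hT : taggedEdges (G.attach ⟨W₁, .merge t₁ t₂ t, W₂⟩).edges =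
      (taggedEdges G.edges).filter (fun x => x.1 || decide (some x.2.tgt ≠ R.head?)) ++
        R.head?.toList.map (fun c => (false, ⟨a, c, t⟩)) := by
    rw [hG, taggedEdges_append, List.foldl_cons, List.foldl_nil, insertEdge_of_exists]
    intro c hc
    refine ⟨(false, ⟨b, c, t₂⟩), (h.mem_false _).2 (Or.inl ?_), rfl⟩
    rw [hpath, pathEdges_append_cons _ _ _ _ _ hP', pathEdges_cons_cons]
    simp [Option.mem_def.1 hc]
  rw [hB] at hp
  simp only [List.pairwise_append, List.pairwise_cons, List.mem_cons] at hp
  obtain ⟨-, ⟨haR, hbR, hRp⟩, hPR⟩ := hp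
  have hab := haR _ (Or.inl rfl)
  replace haR := fun u hu => haR u (Or.inr hu)
  have hPa := fun u hu => hPR u hu a (Or.inl rfl)
  replace hPR := fun u hu v hv => hPR u hu v (Or.inr (Or.inr hv))
  have hcR : ∀ c ∈ R.head?, c ∈ R := fun c hc => List.mem_of_mem_head? hc
  have hmem_false : ∀ e, ((false, e) ∈ taggedEdges G.edges ∧ some e.tgt ≠ R.head?) ↔
      e ∈ pathEdges (P ++ [a]) W₁ ∨ e ∈ pathEdges R W₂ ∨ e = ⟨a, b, t₁⟩ ∨ e ∈ done := by
    intro e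
    have h1 := mem_pathEdges_and_ne_head (l := t₂) (W₂ := W₂) (e := e) hnodup hP'
    rw [← hpath, hpath', List.mem_append, List.mem_singleton] at h1
    have h2 : e ∈ done → some e.tgt ≠ R.head? := by
      intro he hc
      obtain ⟨h3, h4⟩ := h.done_spec e he
      -- Were the target still on the bottom path, `done_spec` applied to it would give `p e.tgt < p
      -- e.tgt`.
      have := h4 e.tgt (by rw [hB]; simp [hcR e.tgt hc.symm]) h3
      exact this.false
    rw [h.mem_false, or_and_right, h1, and_iff_left_of_imp h2]
    clear * -
    grind
  refine ⟨?_, ?_, ?_, ?_, ?_, ?_⟩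
  · rw [hbot]
    exact (hB ▸ h.sorted).sublist hsub
  · intro e
    rw [hT]
    simp [h.mem_true]
  · intro e
    rw [hT, hbot, pathEdges_append_cons _ _ _ _ _ hP, pathEdges_cons_cons]
    have := hmem_false e
    simp only [List.mem_append, List.mem_filter, List.mem_cons, List.mem_map, Prod.mk.injEq,
      Bool.false_or, decide_eq_true_eq, this, true_and]
    clear * -
    grind
  · intro e he
    rw [hbot]
    rcases List.mem_cons.1 he with rfl | he
    · refine ⟨hab, fun c hc hlt => ?_⟩
      rcases List.mem_append.1 hc with hc | hc
      · exact absurd hlt (hPa c hc).not_gt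
      · rcases List.mem_cons.1 hc with rfl | hc
        · exact absurd hlt (lt_irrefl _)
        · exact hbR c hc
    · obtain ⟨h1, h2⟩ := h.done_spec e he
      exact ⟨h1, fun c hc => h2 c (hB ▸ hsub.subset hc)⟩
  · have hpair := h.pairwise
    rw [hT]
    rw [List.pairwise_map] at hpair ⊢
    rw [List.pairwise_append]
    refine ⟨hpair.filter _, by cases R.head? <;> simp, ?_⟩
    rintro ⟨s, x⟩ hx y hy
    simp only [List.mem_filter, Bool.or_eq_true, decide_eq_true_eq] at hx
    simp only [List.mem_map, Option.mem_toList] at hy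
    obtain ⟨c, hc, rfl⟩ := hy
    obtain ⟨hx, hx'⟩ := hx
    cases s
    · have hac := haR c (hcR c hc)
      have hbc := hbR c (hcR c hc)
      -- Among the surviving last edges, only `a → b` and finished edges can start at `a`; both end
      -- before `c`.
      have h1 : p x.tgt ≠ p c ∧ (p x.src = p a → p x.tgt < p c) := by
        rcases (hmem_false x).1 ⟨hx, by simpa using hx'⟩ with hx | hx | rfl | hx
        · obtain ⟨hs, ht⟩ := pathEdges_spec hx
          rw [List.dropLast_concat] at hs
          have := hPa _ hs
          rcases List.mem_append.1 (List.mem_of_mem_tail ht) with ht | ht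
          · have := hPR _ ht _ (hcR c hc)
            omega
          · obtain rfl := List.mem_singleton.1 ht
            omega
        · obtain ⟨hs, ht⟩ := pathEdges_spec hx
          have := haR _ (List.mem_of_mem_dropLast hs)
          match R, hc, ht, hRp with
          | d :: R, hc, ht, hRp =>
            obtain rfl : d = c := by simpa using hc
            have := (List.pairwise_cons.1 hRp).1 _ ht
            omega
        · exact ⟨hbc.ne, fun _ => hbc⟩
        · obtain ⟨h1, h2⟩ := h.done_spec x hx
          have := h2 c (by rw [hB]; simp [hcR c hc])
          omega
      exact ⟨fun e => absurd e h1.1, fun e => Or.inr (Or.inr ⟨rfl, rfl, h1.2 e⟩)⟩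
    · exact ⟨fun _ => ⟨rfl, rfl⟩, fun _ => Or.inl ⟨rfl, rfl⟩⟩
  · rw [hT]
    refine forall_head_append (q := fun e => decide (some e.tgt ≠ R.head?)) h.head_tagged ?_
    intro hnil
    have := (h.mem_false ⟨a, b, t₁⟩).2 (Or.inl (by
      rw [hpath, pathEdges_append_cons _ _ _ _ _ hP', hpath']
      simp))
    simp [hnil] at this

theorem MergeInv.foldl_attach {p : ℕ → ℕ} {M : List Step} {B : List ℕ} {w : Word}
    {arcs first done : List PlaneEdge} (hM : Merges M B w arcs) {G : GeometricDiagram}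
    (hB : G.bottom = B) (h : MergeInv p G w first done) :
    MergeInv p (M.foldl GeometricDiagram.attach G) [Letter.x] first (arcs.reverse ++ done) ∧
      (M.foldl GeometricDiagram.attach G).bottom.length = 1 ∧
      (M.foldl GeometricDiagram.attach G).numVertices = G.numVertices := by
  induction hM generalizing G done with
  | nil a => exact ⟨h, by simp [hB], rfl⟩
  | @cons M P R W₁ W₂ arcs a b t₁ t₂ t hP hR hM ih =>
    have hG := attach_merge (t₁ := t₁) (t₂ := t₂) (t := t) (W₂ := W₂) hB hP
    obtain ⟨h1, h2, h3⟩ := ih (G := G.attach ⟨W₁, .merge t₁ t₂ t, W₂⟩) (by rw [hG])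
      (h.attach (t := t) hB hP)
    refine ⟨?_, h2, h3.trans (by rw [hG])⟩
    rw [List.reverse_cons, List.append_assoc]
    exact h1

/-! ### Decomposition at the peak and the isomorphism -/

theorem IsRewriting.append {w w' : Word} {l l' : List Step} (h : IsRewriting w (l ++ l') w') :
    ∃ u, IsRewriting w l u ∧ IsRewriting u l' w' := by
  induction l generalizing w with
  | nil => exact ⟨w, rfl, h⟩
  | cons s l ih =>
    obtain ⟨h1, h2⟩ := h
    obtain ⟨u, hu, hu'⟩ := ih h2
    exact ⟨u, ⟨h1, hu⟩, hu'⟩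

theorem IsRewriting.getD_eq_source {w w' : Word} {l : List Step} (h : IsRewriting w l w') (j : ℕ)
    (hj : j < l.length) : (w :: l.map Step.target).getD j [] = l[j].source := by
  induction l generalizing w j with
  | nil => simp at hj
  | cons s l ih =>
    obtain ⟨h1, h2⟩ := h
    cases j with
    | zero => simpa using h1
    | succ j => simpa using ih h2 j (by simpa using hj)

theorem Diagram.word_eq_source (Δ : Diagram) (j : ℕ) (hj : j < Δ.steps.length) :
    Δ.word j = Δ.steps[j].source :=
  Δ.isRewriting.getD_eq_source j hj

theorem Diagram.word_succ_eq_target (Δ : Diagram) (j : ℕ) (hj : j < Δ.steps.length) :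
    Δ.word (j + 1) = Δ.steps[j].target := by
  simp [Diagram.word, hj]

/-- A diagram with the single-peak condition consists of splittings, followed by inverse
splittings. -/
theorem Diagram.SinglePeak.exists_append {Δ : Diagram} (h : Δ.SinglePeak) :
    ∃ S M, Δ.steps = S ++ M ∧ (∀ s ∈ S, ∃ W₁ l t₁ t₂ W₂, s = ⟨W₁, .split l t₁ t₂, W₂⟩) ∧
      ∀ s ∈ M, ∃ W₁ t₁ t₂ t W₂, s = ⟨W₁, .merge t₁ t₂ t, W₂⟩ := by
  obtain ⟨i, ⟨hi, h1, h2⟩, -⟩ := h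
  refine ⟨Δ.steps.take i, Δ.steps.drop i, (List.take_append_drop _ _).symm, ?_, ?_⟩
  · intro s hs
    obtain ⟨j, hj, rfl⟩ := List.mem_iff_getElem.1 hs
    rw [List.length_take] at hj
    have hj' : j < Δ.steps.length := by omega
    have := h1 j (by omega)
    rw [Δ.word_eq_source j hj', Δ.word_succ_eq_target j hj'] at this
    rw [List.getElem_take]
    match Δ.steps[j], this with
    | ⟨W₁, .split l t₁ t₂, W₂⟩, _ => exact ⟨_, _, _, _, _, rfl⟩
    | ⟨W₁, .merge t₁ t₂ t, W₂⟩, this =>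
      simp [Step.source, Step.target, Cell.top, Cell.bot] at this
  · intro s hs
    obtain ⟨j, hj, rfl⟩ := List.mem_iff_getElem.1 hs
    rw [List.length_drop] at hj
    have hj' : i + j < Δ.steps.length := by omega
    have := h2 (i + j) (by omega) hj'
    rw [Δ.word_eq_source _ hj', Δ.word_succ_eq_target _ hj'] at this
    rw [List.getElem_drop]
    match Δ.steps[i + j], this with
    | ⟨W₁, .merge t₁ t₂ t, W₂⟩, _ => exact ⟨_, _, _, _, _, rfl⟩
    | ⟨W₁, .split l t₁ t₂, W₂⟩, this =>
      simp [Step.source, Step.target, Cell.top, Cell.bot] at this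

theorem SplitInv.foldl_attach {S₀ S : List Step} {G : GeometricDiagram} {w w' : Word}
    {arcs : List PlaneEdge} (h : SplitInv S₀ G w arcs) (hw : IsRewriting w S w')
    (hS : ∀ s ∈ S, ∃ W₁ l t₁ t₂ W₂, s = ⟨W₁, .split l t₁ t₂, W₂⟩) :
    ∃ arcs', SplitInv (S₀ ++ S) (S.foldl GeometricDiagram.attach G) w' arcs' := by
  induction S generalizing S₀ G w arcs with
  | nil =>
    obtain rfl : w = w' := hw
    exact ⟨arcs, by simpa using h⟩
  | cons s S ih =>
    obtain ⟨rfl, h2⟩ := hw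
    obtain ⟨W₁, l, t₁, t₂, W₂, rfl⟩ := hS s (List.mem_cons_self)
    simp only [Step.source, Step.target, Cell.top, Cell.bot, List.append_assoc, List.cons_append,
      List.nil_append] at h h2
    obtain ⟨arcs', h'⟩ := h.attach (t₁ := t₁) (t₂ := t₂)
    have := ih h' h2 fun s hs => hS s (List.mem_cons_of_mem _ hs)
    rwa [List.append_assoc] at this

theorem exists_merges {M : List Step} {w : Word} {B : List ℕ} (hw : IsRewriting w M [Letter.x])
    (hM : ∀ s ∈ M, ∃ W₁ t₁ t₂ t W₂, s = ⟨W₁, .merge t₁ t₂ t, W₂⟩) (hB : B.length = w.length) :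
    ∃ arcs, Merges M B w arcs := by
  induction M generalizing w B with
  | nil =>
    obtain rfl : w = [Letter.x] := hw
    obtain ⟨a, rfl⟩ := List.length_eq_one_iff.1 hB
    exact ⟨[], Merges.nil a⟩
  | cons s M ih =>
    obtain ⟨rfl, h2⟩ := hw
    obtain ⟨W₁, t₁, t₂, t, W₂, rfl⟩ := hM s (List.mem_cons_self)
    simp only [Step.source, Step.target, Cell.top, Cell.bot, List.append_assoc, List.cons_append,
      List.nil_append] at hB h2 ⊢
    obtain ⟨P, F, rfl, hP, hF⟩ := exists_append_of_length_eq hB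
    match F, hF with
    | a :: b :: R, hF =>
      have hR : R.length = W₂.length := by simpa using hF
      obtain ⟨arcs, h⟩ := ih (B := P ++ a :: R) h2
        (fun s hs => hM s (List.mem_cons_of_mem _ hs)) (by simp [hP, hR])
      exact ⟨_, Merges.cons b t₁ t₂ hP hR h⟩

theorem map_idxOf_self {B : List ℕ} (hB : B.Nodup) :
    B.map (fun u => B.idxOf u) = List.range B.length := by
  refine List.ext_getElem (by simp) fun i h1 h2 => ?_
  simp [hB.idxOf_getElem]

theorem Diagram.SinglePeak.nonempty_iso {Δ : Diagram} (hΔ : Δ.SinglePeak) :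
    ∃ h : Δ.upperTree.numLeaves = Δ.lowerTree.numLeaves,
      Nonempty (LabeledPlaneGraph.Iso Δ.thompsonGraph
        (gammaGraph Δ.upperTree Δ.lowerTree h)) := by
  obtain ⟨S, M, hSM, hS, hM⟩ := hΔ.exists_append
  have hrew := Δ.isRewriting
  rw [hSM] at hrew
  obtain ⟨w, hw, hw'⟩ := hrew.append
  obtain ⟨arcs, hsplit⟩ := splitInv_trivial.foldl_attach hw hS
  rw [List.nil_append] at hsplit
  set G := S.foldl GeometricDiagram.attach GeometricDiagram.trivial with hG
  obtain ⟨arcs', hmerges⟩ := exists_merges hw' hM hsplit.merges.length_eq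
  have hnodup : G.bottom.Nodup := hsplit.perm.nodup_iff.2 List.nodup_range
  have hlen : G.bottom.length = G.numVertices := by simpa using hsplit.perm.length_eq
  -- The left-to-right numbering at the peak, where the bottom path is a permutation of all
  -- vertices.
  set p : ℕ → ℕ := fun u => G.bottom.idxOf u with hp
  have hmap := map_idxOf_self hnodup
  obtain ⟨hinv, hone, hnum⟩ :=
    MergeInv.foldl_attach hmerges rfl (hsplit.mergeInv (pairwise_idxOf_lt hnodup))
  have hgeo : Δ.geometric = M.foldl GeometricDiagram.attach G := by
    rw [Diagram.geometric, hSM, List.foldl_append]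
  rw [← hgeo] at hinv hone hnum
  obtain ⟨hlow, hlow'⟩ := hsplit.merges.bottomTree_spec hmerges hmap
  -- Turning the diagram upside down exchanges the roles of `S` and `M`, so the statement about the
  -- lower tree also yields the upper tree.
  have hM' : Merges (((M.reverse.map Step.inv).reverse).map Step.inv) G.bottom w arcs' := by
    rw [← List.map_reverse, List.reverse_reverse, List.map_map,
      show Step.inv ∘ Step.inv = id from funext Step.inv_inv, List.map_id]
    exact hmerges
  obtain ⟨hup, hup'⟩ := hM'.bottomTree_spec hsplit.merges hmap
  rw [← List.map_append, ← List.reverse_append, ← hSM, ← Diagram.upperTree] at hup hup'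
  rw [← hSM, ← Diagram.lowerTree] at hlow hlow'
  refine ⟨hup.trans hlow.symm, ?_⟩
  have hlt : ∀ u : Fin Δ.geometric.numVertices, p u < Δ.upperTree.numLeaves := by
    intro u
    rw [hup]
    refine List.idxOf_lt_length_of_mem (hsplit.perm.mem_iff.2 ?_)
    rw [List.mem_range, ← hnum]
    exact u.2
  have hcard : Δ.geometric.numVertices = Δ.upperTree.numLeaves := by
    rw [hup, hlen, hnum]
  have hbij : Function.Bijective (fun u : Fin Δ.geometric.numVertices =>
      (⟨p u, hlt u⟩ : Fin Δ.upperTree.numLeaves)) := by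
    rw [Fintype.bijective_iff_injective_and_card]
    refine ⟨fun u v huv => Fin.ext ?_, by simp [hcard]⟩
    have hu : (u : ℕ) ∈ G.bottom := hsplit.perm.mem_iff.2 (by
      rw [List.mem_range, ← hnum]
      exact u.2)
    exact (List.idxOf_inj hu).1 (Fin.ext_iff.1 huv)
  refine nonempty_leftRightGraphIso _ _ p (Equiv.ofBijective _ hbij) (fun _ => rfl)
    (T := taggedEdges Δ.geometric.edges)
    (T' := (Δ.upperTree.leftArcs 0).map (Prod.mk true) ++
      (Δ.lowerTree.leftArcs 0).reverse.map (Prod.mk false))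
    Δ.geometric.map_snd_taggedEdges (by simp [Function.comp_def]) hinv.pairwise
    (pairwise_above_gamma _ _) ?_ ?_
  -- The final bottom path is a single edge to the terminal vertex, so all last edges are finished
  -- ones, namely the arcs of the merges.
  · have hpath : ∀ e, e ∉ pathEdges Δ.geometric.bottom [Letter.x] := by
      obtain ⟨a, ha⟩ := List.length_eq_one_iff.1 hone
      simp [ha, pathEdges]
    rintro ⟨b, y⟩
    cases b
    · simp [hlow'.mem_iff, hinv.mem_false, hpath, hp]
    · simp [hup'.mem_iff, hinv.mem_true, hp]
  · intro x hx y hy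
    rw [(hinv.head_tagged x hx).2]
    have h0 : p 0 = 0 := by
      have := hsplit.head
      rw [hp]
      cases hB : G.bottom with
      | nil => rfl
      | cons a B =>
        rw [hB] at this
        obtain rfl : a = 0 := by simpa using this
        simp
    rw [h0]
    -- The first tagged edge has tag `true`, so the upper tree has an arc. The second list therefore
    -- starts with an upper arc, whose source is `0`.
    have hnil : Δ.upperTree.leftArcs 0 ≠ [] := by
      have := hinv.head_tagged x hx
      have hx' := List.mem_of_mem_head? hx
      have hx1 : (true, x.2) ∈ taggedEdges Δ.geometric.edges := by
        rw [← this.1]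
        exact hx'
      have := (hinv.mem_true x.2).1 hx1
      intro hnil
      have h3 := hup'.mem_iff.2 (List.mem_map_of_mem (f := PlaneEdge.relabel p) this)
      simp [hnil] at h3
    obtain ⟨e, L, heL⟩ := List.exists_cons_of_ne_nil hnil
    have := Δ.upperTree.head_leftArcs_src 0
    rw [heL] at this hy
    simp only [List.map_cons, List.cons_append, List.head?_cons, Option.mem_def,
      Option.some.injEq] at hy
    rw [← hy]
    exact (this e rfl).symm

end VirtualThompson

theorem mainTheorem5 (Δ : VirtualThompson.Diagram) (hΔ : Δ.SinglePeak) :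
    ∃ h : Δ.upperTree.numLeaves = Δ.lowerTree.numLeaves,
      Nonempty (VirtualThompson.LabeledPlaneGraph.Iso Δ.thompsonGraph
        (VirtualThompson.gammaGraph Δ.upperTree Δ.lowerTree h)) :=
  hΔ.nonempty_iso
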